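/- **Setting.** Let $\mathcal L=\ell_0+\kappa\,\partial_x^2$ with real constants $\ell_0$ and $\kappa\neq0$. This is a local, isotropic, homogeneous, linear operator of order two. Let $F,g:\mathbb R\to\mathbb R$ be smooth, and consider the PDE $$\partial_tu=\mathcal LF(u)+g(u).\tag{1}$$ Let $X_i=ih$ ($i\in\mathbb Z$) be an equi-spaced grid, let $p\ge2$ and $r\ge0$ be integers, let $I\subseteq\mathbb R$ be open, and let $h_0>0$. **The discrete model.** A *slow manifold model of (1) to residuals $O(\gamma^p)$* consists, for grid values $U_j\in I$ and spacings $0<h<h_0$, of subgrid fields and an evolution law $$v_i(x;U,\gamma)=\sum_{k=0}^{p-1}\gamma^kV_k\Big(\frac{x-X_i}{h};U_{i-r},\dots,U_{i+r};h\Big),\qquad \frac{dU_i}{dt}=G_i(U,\gamma)=\sum_{k=0}^{p-1}\gamma^k\,\Gamma_k(U_{i-r},\dots,U_{i+r};h)$$ with the following properties. 1. The coefficients $V_k(\xi;w;h)$ are twice continuously differentiable on $[-1,1]\times I^{2r+1}\times[0,h_0)$, that is, down to $h=0$. 2. At $\gamma=0$ the fields are constant in each element: $v_i(x;U,0)=U_i$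 on $[X_{i-1},X_{i+1}]$. 3. The grid values are $U_i=v_i(X_i;U,\gamma)$. 4. Pointwise, as $\gamma\to0$, the PDE holds on each of the overlapping elements: $$\sum_j\frac{\partial v_i}{\partial U_j}\,G_j=\mathcal LF(v_i)+g(v_i)+O(\gamma^p),\qquad X_{i-1}<x<X_{i+1}.$$ The left-hand side is $\partial_tv_i$ when $U$ evolves by the model. 5. As $\gamma\to0$ the coupling conditions hold: $$F[v_i(X_{i\pm1})]=\gamma F[v_{i\pm1}(X_{i\pm1})]+(1-\gamma)F[v_i(X_i)]+O(\gamma^p).$$ **Claim.** At full coupling $\gamma=1$ every such model $dU_i/dt=G_i(U,1)$ is consistent with (1) as $h\to0$. Precisely, let $T\subseteq\mathbb R$ be open, let $u:\mathbb R\times T\to I$ be smooth, and let $K\subset\mathbb R\times T$ be compact. Then $$G_i\big((u(X_j,t))_j,1\big)-\big[\mathcal LF(u)+g(u)\big](X_i,t)\;\longrightarrow\;0\qquad(h\to0),$$ uniformly over all $i,t$ with $(X_i,t)\in K$. In particular, if $u$ solves (1) on $\mathbb R\times T$, then $$\partial_tu(X_i,t)-G_i\big((u(X_j,t))_j,1\big)\to0$$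 in the same sense, so the grid values of solutions of (1) satisfy the discrete model up to a vanishing error. -/

import Mathlib

open Set Filter Topology Asymptotics
open scoped ContDiff

namespace Holistic

/-- The grid points `X_i = i h`. -/
noncomputable def gridPoint (h : ℝ) (i : ℤ) : ℝ := (i : ℝ) * h

/-- The local, homogeneous, isotropic, linear operators in one space dimension:
`(L f)(x) = ∑_k a_k f^{(2k)}(x)`, with constant coefficients (homogeneous) and
derivatives of even order only (isotropic, that is, invariant under `x ↦ -x`). -/
noncomputable def evenOperator (a : Polynomial ℝ) (f : ℝ → ℝ) (x : ℝ) : ℝ :=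
  a.sum fun k c => c * iteratedDeriv (2 * k) f x

/-- The entries `U_{i-r}, …, U_{i+r}` of a grid function. -/
def stencil (r : ℕ) (U : ℤ → ℝ) (i : ℤ) : Fin (2 * r + 1) → ℝ :=
  fun j => U (i + ((j : ℕ) : ℤ) - (r : ℤ))

/-- The data of a closed discrete model, as polynomials of degree `< p` in the coupling parameter.
The grid is homogeneous, so that all elements share the same coefficients, which depend
on the grid values in a stencil around the element and on the spacing `h`.
* `field k ξ w h` is the coefficient of `γ ^ k` in the subgrid field, at the position
  `ξ = (x - X_i) / h ∈ [-1, 1]` relative to the element.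
* `rate k w h` is the coefficient of `γ ^ k` in the evolution of the central grid value. -/
structure Model (p r : ℕ) where
  field : Fin p → ℝ → (Fin (2 * r + 1) → ℝ) → ℝ → ℝ
  rate : Fin p → (Fin (2 * r + 1) → ℝ) → ℝ → ℝ

variable {p r : ℕ}

/-- The subgrid field `v_i(x; U, γ)` of the `i`-th element. -/
noncomputable def Model.subgrid (M : Model p r) (h γ : ℝ) (U : ℤ → ℝ) (i : ℤ) (x : ℝ) : ℝ :=
  ∑ k : Fin p, γ ^ (k : ℕ) * M.field k ((x - gridPoint h i) / h) (stencil r U i) h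

/-- The right-hand side of the discrete model `dU_i/dt = G_i(U, γ)`. -/
noncomputable def Model.evolution (M : Model p r) (h γ : ℝ) (U : ℤ → ℝ) (i : ℤ) : ℝ :=
  ∑ k : Fin p, γ ^ (k : ℕ) * M.rate k (stencil r U i) h

/-- The time derivative of the subgrid field when the grid values evolve by the discrete model:
by the chain rule it is `∑_j (∂v_i/∂U_j) G_j(U, γ)`. -/
noncomputable def Model.subgridTimeDeriv (M : Model p r) (h γ : ℝ) (U : ℤ → ℝ) (i : ℤ)
    (x : ℝ) : ℝ :=
  ∑ k : Fin p, γ ^ (k : ℕ) *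
    fderiv ℝ (fun w => M.field k ((x - gridPoint h i) / h) w h) (stencil r U i)
      (stencil r (M.evolution h γ U) i)

/-- `M` is a slow manifold model of `∂_t u = L F(u) + g(u)` on overlapping elements, for grid
values in `I` and spacings `0 < h < h₀`, constructed to residuals `O(γ ^ p)`. -/
structure Model.IsSlowManifold (M : Model p r) (a : Polynomial ℝ) (F g : ℝ → ℝ)
    (I : Set ℝ) (h₀ : ℝ) : Prop where
  /-- The subgrid field, on the element rescaled to `[-1, 1]`, depends smoothly (twice
  continuously differentiably) on position, grid values and spacing, down to `h = 0`. -/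
  smooth : ∀ k : Fin p, ContDiffOn ℝ 2
    (fun z : ℝ × (Fin (2 * r + 1) → ℝ) × ℝ => M.field k z.1 z.2.1 z.2.2)
    (Icc (-1) 1 ×ˢ (univ.pi fun _ => I) ×ˢ Ico 0 h₀)
  /-- Without coupling, the slow subspace consists of the fields constant in each element. -/
  base : ∀ h ∈ Ioo 0 h₀, ∀ U : ℤ → ℝ, (∀ j, U j ∈ I) → ∀ i : ℤ,
    ∀ x ∈ Icc (gridPoint h (i - 1)) (gridPoint h (i + 1)), M.subgrid h 0 U i x = U i
  /-- The grid values are `U_i = v_i(X_i)`. -/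
  amplitude : ∀ h ∈ Ioo 0 h₀, ∀ U : ℤ → ℝ, (∀ j, U j ∈ I) → ∀ (i : ℤ) (γ : ℝ),
    M.subgrid h γ U i (gridPoint h i) = U i
  /-- `∂_t v_i = L F(v_i) + g(v_i)` on `(X_{i-1}, X_{i+1})`, to residuals `O(γ ^ p)`. -/
  pde : ∀ h ∈ Ioo 0 h₀, ∀ U : ℤ → ℝ, (∀ j, U j ∈ I) → ∀ i : ℤ,
    ∀ x ∈ Ioo (gridPoint h (i - 1)) (gridPoint h (i + 1)),
      (fun γ : ℝ => M.subgridTimeDeriv h γ U i x -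
        (evenOperator a (fun y => F (M.subgrid h γ U i y)) x + g (M.subgrid h γ U i x)))
        =O[𝓝 0] fun γ : ℝ => γ ^ p
  /-- The coupling conditions at `X_{i+1}` (`s = 1`) and at `X_{i-1}` (`s = -1`),
  to residuals `O(γ ^ p)`. -/
  coupling : ∀ h ∈ Ioo 0 h₀, ∀ U : ℤ → ℝ, (∀ j, U j ∈ I) → ∀ i s : ℤ, s = 1 ∨ s = -1 →
      (fun γ : ℝ => F (M.subgrid h γ U i (gridPoint h (i + s))) -
        (γ * F (M.subgrid h γ U (i + s) (gridPoint h (i + s)))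
          + (1 - γ) * F (M.subgrid h γ U i (gridPoint h i))))
        =O[𝓝 0] fun γ : ℝ => γ ^ p

/-- The discrete model at full coupling `γ = 1` is consistent with `∂_t u = L F(u) + g(u)`:
as `h → 0`, locally uniformly in space and time,
* on the grid values of every smooth field `u(x, t)` the right-hand side of the discrete
  model tends to that of the PDE, and
* the grid values of every smooth solution of the PDE satisfy the discrete model up to
  an error that tends to zero. -/
def Model.IsConsistent (M : Model p r) (a : Polynomial ℝ) (F g : ℝ → ℝ)
    (I : Set ℝ) (h₀ : ℝ) : Prop :=
  ∀ (T : Set ℝ) (u : ℝ → ℝ → ℝ), IsOpen T →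
    ContDiffOn ℝ ∞ (fun z : ℝ × ℝ => u z.1 z.2) (univ ×ˢ T) →
    (∀ x, ∀ t ∈ T, u x t ∈ I) →
    ∀ K : Set (ℝ × ℝ), IsCompact K → K ⊆ univ ×ˢ T → ∀ ε > 0,
      ∃ h₁ ∈ Ioc 0 h₀, ∀ h ∈ Ioo 0 h₁, ∀ (i : ℤ) (t : ℝ), (gridPoint h i, t) ∈ K →
        |M.evolution h 1 (fun j => u (gridPoint h j) t) i -
          (evenOperator a (fun y => F (u y t)) (gridPoint h i) + g (u (gridPoint h i) t))| < ε ∧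
        ((∀ x, ∀ τ ∈ T,
            deriv (u x) τ = evenOperator a (fun y => F (u y τ)) x + g (u x τ)) →
          |deriv (u (gridPoint h i)) t -
            M.evolution h 1 (fun j => u (gridPoint h j) t) i| < ε)

end Holistic

/-!
The proof expands everything in powers of the coupling parameter. Let `V_k` and `Γ_k` be the
coefficients of `γ ^ k` in the subgrid field and in the evolution law, and `f_k`, `g_k` those of
`F (v)` and `g (v)`. They are polynomials in the `V_m` with `m ≥ 1`, whose coefficients are the
derivatives of `F` and `g` at the grid value (`jet`, `iteratedDeriv_two_apply_sub_isBigO`), because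
the leading coefficient of the field is the grid value. With `a₀` and `a₁` the coefficients of the
operator, the PDE to residuals `O(γ ^ p)` says that `a₁ ∂²f_k/∂x² = Γ_k + R_k` for `k < p`, where
the remainder `R_k` consists of the terms `∂V_m/∂U · Γ_{k-m}`, `m ≥ 1`, and of `-a₀ f_k - g_k`
(`Model.coeff_one_mul_iteratedDeriv_jetCoeff`).

The coupling conditions fix the second difference of `f_k` over the element: it is that of the grid
function `F (U)` for `k = 1`, and zero for `k ≥ 2`. A function whose second derivative is within
`ε` of a constant has second difference within `h² ε` of `h²` times that constant
(`abs_second_difference_sub_le`). Hence `Γ_1` is `a₁` times the second difference quotient of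
`F (U)`, and `Γ_k` is zero for `k ≥ 2`, both up to the size of `R_k` (`Model.abs_sub_rateCoeff_le`),
while `Γ_0 = a₀ F (U) + g (U)` exactly. At full coupling the sum of these is the right-hand side of
the PDE, once `R_k → 0` is known on the grid values of smooth fields.

As `h → 0` these grid values become constant in each stencil, equal to `c` say, and the lower rates
converge to a limit that is the same at all points of the stencil. So by regularity of the fields
down to `h = 0` it suffices that at `h = 0`, on the constant grid values `c`, the `V_m` with
`m ≥ 1` and their derivatives in the direction of the constants vanish. This holds where `F' (c) ≠ 0`,
by another induction (`Model.fieldCoeff_const_eq_zero`): on constant grid values the coupling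
conditions say that `f_k` vanishes at both ends of the element, and `h² R_k → 0`. It extends by
continuity to the closure of this set. Near all other `c` the function `F` is constant, so that
`f_k = 0` and `Γ_k = 0` for `k ≥ 1`, and the diffusion term vanishes too. Both cases meet in
`Model.tendsto_rateCoeff`, and uniformity is compactness.
-/

/-! ### Polynomials of small order at zero -/

open Polynomial in
/-- The orders of a residual may be compared one by one: a polynomial that is `O(γ ^ p)` at `0` has
no terms of degree less than `p`. -/
theorem Polynomial.coeff_eq_zero_of_eval_isBigO {p : ℕ} {q : ℝ[X]}
    (hq : (fun γ : ℝ => q.eval γ) =O[𝓝[≠] 0] fun γ : ℝ => γ ^ p) {k : ℕ} (hk : k < p) :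
    q.coeff k = 0 := by
  induction p generalizing q k with
  | zero => omega
  | succ p ih =>
    have h0 : q.coeff 0 = 0 := by
      have h1 : Tendsto (fun γ : ℝ => γ ^ (p + 1)) (𝓝[≠] 0) (𝓝 0) := by
        have : Tendsto (fun γ : ℝ => γ ^ (p + 1)) (𝓝 0) (𝓝 (0 ^ (p + 1))) :=
          (continuous_pow (p + 1)).tendsto 0
        rw [zero_pow (by omega)] at this
        exact this.mono_left nhdsWithin_le_nhds
      have h2 := hq.trans_tendsto h1
      have h3 : Tendsto (fun γ : ℝ => q.eval γ) (𝓝[≠] 0) (𝓝 (q.eval 0)) :=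
        (q.continuous.tendsto 0).mono_left nhdsWithin_le_nhds
      rw [coeff_zero_eq_eval_zero]
      exact tendsto_nhds_unique h3 h2
    obtain ⟨q', rfl⟩ := X_dvd_iff.2 h0
    cases k with
    | zero => exact h0
    | succ k =>
      rw [coeff_X_mul]
      refine ih ?_ (by omega)
      obtain ⟨C, hC⟩ := hq.bound
      refine IsBigO.of_bound C ?_
      filter_upwards [hC, self_mem_nhdsWithin] with γ hγ hne
      have hpos : 0 < |γ| := abs_pos.2 hne
      simp only [eval_mul, eval_X, norm_mul, pow_succ, Real.norm_eq_abs] at hγ ⊢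
      rw [← mul_assoc, mul_comm |γ|] at hγ
      exact le_of_mul_le_mul_right hγ hpos

/-! ### Second differences of functions with nearly constant second derivative -/

theorem ContDiffAt.deriv_real {f : ℝ → ℝ} {x : ℝ} {n m : WithTop ℕ∞} (hf : ContDiffAt ℝ n f x)
    (hmn : m + 1 ≤ n) : ContDiffAt ℝ m (deriv f) x := by
  have := (hf.fderiv_right hmn).clm_apply (contDiffAt_const (c := (1 : ℝ)))
  simpa only [fderiv_apply_one_eq_deriv] using this

theorem convexOn_add_parabola {φ : ℝ → ℝ} {x h B : ℝ}
    (hφ : ContinuousOn φ (Icc (x - h) (x + h)))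
    (hφ₂ : ∀ y ∈ Ioo (x - h) (x + h), ContDiffAt ℝ 2 φ y)
    (hB : ∀ y ∈ Ioo (x - h) (x + h), -B ≤ iteratedDeriv 2 φ y) :
    ConvexOn ℝ (Icc (x - h) (x + h)) (fun y => φ y + B / 2 * (y - x) ^ 2) := by
  have hpar : ContDiff ℝ 2 (fun y : ℝ => B / 2 * (y - x) ^ 2) := by fun_prop
  have hsum : ∀ y ∈ Ioo (x - h) (x + h), ContDiffAt ℝ 2 (fun y => φ y + B / 2 * (y - x) ^ 2) y :=
    fun y hy => (hφ₂ y hy).add hpar.contDiffAt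
  refine convexOn_of_deriv2_nonneg (convex_Icc _ _) (hφ.add hpar.continuous.continuousOn) ?_ ?_ ?_
  · rw [interior_Icc]
    exact fun y hy => ((hsum y hy).differentiableAt (by norm_num)).differentiableWithinAt
  · rw [interior_Icc]
    intro y hy
    have := (hsum y hy).deriv_real (m := 1) (by norm_num)
    exact (this.differentiableAt (by norm_num)).differentiableWithinAt
  · rw [interior_Icc]
    intro y hy
    rw [← iteratedDeriv_eq_iterate]
    have h2 : iteratedDeriv 2 (fun y : ℝ => B / 2 * (y - x) ^ 2) y = B := by
      have e : deriv (fun y : ℝ => B / 2 * (y - x) ^ 2) = fun y => B * (y - x) := by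
        ext y
        have := (((hasDerivAt_id y).sub_const x).pow 2).const_mul (B / 2)
        simp only [id] at this
        refine (this.deriv).trans ?_
        norm_num
        ring
      rw [iteratedDeriv_succ, iteratedDeriv_one, e]
      simp
    rw [iteratedDeriv_fun_add (hφ₂ y hy) hpar.contDiffAt, h2]
    linarith [hB y hy]

/-- A bound on the deviation of `φ''` from a constant bounds the error of the central second
difference of `φ`: adding a parabola makes `φ` convex or concave, and the inequality is convexity
at the midpoint. -/
theorem abs_second_difference_sub_le {φ : ℝ → ℝ} {x h A ε : ℝ} (hh : 0 < h)
    (hφ : ContinuousOn φ (Icc (x - h) (x + h)))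
    (hφ₂ : ∀ y ∈ Ioo (x - h) (x + h), ContDiffAt ℝ 2 φ y)
    (hA : ∀ y ∈ Ioo (x - h) (x + h), |iteratedDeriv 2 φ y - A| ≤ ε) :
    |φ (x + h) + φ (x - h) - 2 * φ x - h ^ 2 * A| ≤ h ^ 2 * ε := by
  have key : ∀ {f : ℝ → ℝ}, ConvexOn ℝ (Icc (x - h) (x + h)) f →
      2 * f x ≤ f (x + h) + f (x - h) := by
    intro f hf
    have hm₁ : x - h ∈ Icc (x - h) (x + h) := by constructor <;> linarith
    have hm₂ : x + h ∈ Icc (x - h) (x + h) := by constructor <;> linarith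
    have := hf.2 hm₁ hm₂ (show (0 : ℝ) ≤ 1 / 2 by norm_num) (show (0 : ℝ) ≤ 1 / 2 by norm_num)
      (by norm_num)
    simp only [smul_eq_mul] at this
    rw [show 1 / 2 * (x - h) + 1 / 2 * (x + h) = x by ring] at this
    linarith
  have h₁ := key (convexOn_add_parabola (B := ε - A) hφ hφ₂ fun y hy => by
    linarith [(abs_le.1 (hA y hy)).1])
  have h₂ := key (convexOn_add_parabola (φ := -φ) (B := ε + A) hφ.neg
    (fun y hy => (hφ₂ y hy).neg) fun y hy => by
      rw [iteratedDeriv_neg]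
      linarith [(abs_le.1 (hA y hy)).2])
  simp only [Pi.neg_apply] at h₁ h₂
  rw [abs_le]
  constructor <;> nlinarith

/-- A maximum principle: `φ ± ε (y - x)² / 2` are convex and concave, so that they are bounded by
their values at the end points. -/
theorem abs_le_of_abs_iteratedDeriv_two_le {φ : ℝ → ℝ} {x h ε : ℝ} (hh : 0 < h)
    (hφ : ContinuousOn φ (Icc (x - h) (x + h)))
    (hφ₂ : ∀ y ∈ Ioo (x - h) (x + h), ContDiffAt ℝ 2 φ y)
    (hε : ∀ y ∈ Ioo (x - h) (x + h), |iteratedDeriv 2 φ y| ≤ ε)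
    (h₁ : φ (x + h) = 0) (h₂ : φ (x - h) = 0) {y : ℝ} (hy : y ∈ Icc (x - h) (x + h)) :
    |φ y| ≤ h ^ 2 * ε / 2 := by
  have hε0 : 0 ≤ ε := (abs_nonneg _).trans (hε x (by constructor <;> linarith))
  have key : ∀ {f : ℝ → ℝ}, ConvexOn ℝ (Icc (x - h) (x + h)) f → ∀ {b : ℝ}, f (x - h) = b →
      f (x + h) = b → f y ≤ b := by
    intro f hf b hb₁ hb₂
    have := hf.le_max_of_mem_Icc (x := x - h) (y := x + h) (by constructor <;> linarith)
      (by constructor <;> linarith) hy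
    simpa [hb₁, hb₂] using this
  have k₁ := key (convexOn_add_parabola (B := ε) hφ hφ₂ fun y hy =>
    (abs_le.1 (hε y hy)).1) (b := h ^ 2 * ε / 2) (by rw [h₂]; ring) (by rw [h₁]; ring)
  have k₂ := key (convexOn_add_parabola (φ := -φ) (B := ε) hφ.neg
    (fun y hy => (hφ₂ y hy).neg) fun y hy => by
      rw [iteratedDeriv_neg]
      linarith [(abs_le.1 (hε y hy)).2]) (b := h ^ 2 * ε / 2)
      (by rw [Pi.neg_apply, h₂]; ring) (by rw [Pi.neg_apply, h₁]; ring)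
  simp only [Pi.neg_apply] at k₂
  have : 0 ≤ ε / 2 * (y - x) ^ 2 := by positivity
  rw [abs_le]
  constructor <;> linarith

/-! ### Taylor remainders -/

/-- The error of the Taylor polynomial of degree `< p` of `H` at `c`, as a function of the
increment. -/
noncomputable def taylorRemainder (p : ℕ) (H : ℝ → ℝ) (c y : ℝ) : ℝ :=
  H (c + y) - ∑ j ∈ Finset.range p, iteratedDeriv j H c / j.factorial * y ^ j

/-- For `p = 0` both Taylor polynomials are empty, so that the truncated subtraction is harmless. -/
theorem hasDerivAt_taylorRemainder (p : ℕ) {H : ℝ → ℝ} (hH : ContDiff ℝ ∞ H) (c y : ℝ) :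
    HasDerivAt (taylorRemainder p H c) (taylorRemainder (p - 1) (deriv H) c y) y := by
  have h1 : HasDerivAt (fun y => H (c + y)) (deriv H (c + y)) y := by
    have := (hH.differentiable (by simp) (c + y)).hasDerivAt
    exact this.comp_const_add c y
  have h2 : HasDerivAt
      (fun y => ∑ j ∈ Finset.range p, iteratedDeriv j H c / j.factorial * y ^ j)
      (∑ j ∈ Finset.range p, iteratedDeriv j H c / j.factorial * (j * y ^ (j - 1))) y :=
    HasDerivAt.fun_sum fun j _ => (hasDerivAt_pow j y).const_mul _
  refine (h1.sub h2).congr_deriv ?_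
  unfold taylorRemainder
  congr 1
  cases p with
  | zero => simp
  | succ p =>
    rw [Finset.sum_range_succ']
    simp only [Nat.cast_zero, zero_mul, mul_zero, add_zero, Nat.add_sub_cancel]
    refine Finset.sum_congr rfl fun j _ => ?_
    rw [iteratedDeriv_succ', Nat.factorial_succ]
    push_cast
    field_simp

theorem taylorRemainder_isBigO (p : ℕ) {H : ℝ → ℝ} (hH : ContDiff ℝ ∞ H) (c : ℝ) :
    taylorRemainder p H c =O[𝓝 0] fun y => y ^ p := by
  induction p generalizing H with
  | zero =>
    simp only [pow_zero]
    refine Tendsto.isBigO_one (c := H (c + 0)) ℝ ?_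
    have : taylorRemainder 0 H c = fun y => H (c + y) := by
      ext y
      simp [taylorRemainder]
    rw [this]
    exact (hH.continuous.comp (continuous_const.add continuous_id)).tendsto 0
  | succ p ih =>
    obtain ⟨C, hC0, hC⟩ := (ih (H := deriv H) ((contDiff_infty_iff_deriv.1 hH).2)).exists_pos
    obtain ⟨δ, hδ, hC⟩ := Metric.eventually_nhds_iff.1 hC.bound
    refine IsBigO.of_bound C ?_
    filter_upwards [Metric.ball_mem_nhds 0 hδ] with y hy
    have h0 : taylorRemainder (p + 1) H c 0 = 0 := by
      simp [taylorRemainder, Finset.sum_range_succ']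
    rw [mem_ball_zero_iff] at hy
    have := Convex.norm_image_sub_le_of_norm_hasDerivWithin_le (𝕜 := ℝ)
      (f := taylorRemainder (p + 1) H c) (f' := fun y => taylorRemainder p (deriv H) c y)
      (s := Metric.closedBall 0 ‖y‖) (x := 0) (y := y) (C := C * ‖y‖ ^ p)
      (fun x _ => (hasDerivAt_taylorRemainder (p + 1) hH c x).hasDerivWithinAt) ?_
      (convex_closedBall _ _) (by simp) (by simp)
    · rwa [h0, sub_zero, sub_zero, mul_assoc, ← pow_succ, ← norm_pow] at this
    · intro x hx
      rw [mem_closedBall_zero_iff] at hx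
      refine (hC (y := x) (by simpa using hx.trans_lt hy)).trans ?_
      rw [norm_pow]
      gcongr

/-! ### Expansions in powers of the coupling parameter -/

theorem iteratedDeriv_two_comp {Q Q₁ Q₂ D : ℝ → ℝ} {x : ℝ}
    (hQ : ∀ y, HasDerivAt Q (Q₁ y) y) (hQ₁ : ∀ y, HasDerivAt Q₁ (Q₂ y) y)
    (hD : ContDiffAt ℝ 2 D x) :
    iteratedDeriv 2 (fun y => Q (D y)) x =
      Q₂ (D x) * deriv D x ^ 2 + Q₁ (D x) * iteratedDeriv 2 D x := by
  have h1 : ∀ᶠ y in 𝓝 x, deriv (fun y => Q (D y)) y = Q₁ (D y) * deriv D y := by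
    filter_upwards [hD.eventually (by simp)] with y hy
    exact ((hQ (D y)).comp y (hy.differentiableAt (by norm_num)).hasDerivAt).deriv
  have h2 : HasDerivAt (deriv D) (iteratedDeriv 2 D x) x := by
    rw [iteratedDeriv_succ, iteratedDeriv_one]
    exact ((hD.deriv_real (m := 1) (by norm_num)).differentiableAt (by norm_num)).hasDerivAt
  have h3 : HasDerivAt (fun y => Q₁ (D y)) (Q₂ (D x) * deriv D x) x :=
    (hQ₁ (D x)).comp x (hD.differentiableAt (by norm_num)).hasDerivAt
  rw [iteratedDeriv_succ, iteratedDeriv_one, EventuallyEq.deriv_eq h1]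
  refine (h3.mul h2).deriv.trans ?_
  ring

namespace Holistic

open Polynomial

/-- The polynomial `v₁ X + ⋯ + v_{p-1} X ^ (p-1)`: the deviation of a subgrid field from its grid
value, as a polynomial in the coupling parameter. -/
noncomputable def deviation (p : ℕ) (v : ℕ → ℝ) : ℝ[X] :=
  ∑ m ∈ Finset.Ico 1 p, C (v m) * X ^ m

/-- The Taylor polynomial of degree `< p` of `H` at `c`, composed with `deviation p v`. Its
coefficients below `p` are those of the expansion of `H (c + v₁ γ + v₂ γ² + ⋯)` in powers
of `γ`; the higher ones have no meaning. -/
noncomputable def jet (p : ℕ) (H : ℝ → ℝ) (c : ℝ) (v : ℕ → ℝ) : ℝ[X] :=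
  ∑ j ∈ Finset.range p, C (iteratedDeriv j H c / j.factorial) * deviation p v ^ j

theorem eval_deviation (p : ℕ) (v : ℕ → ℝ) (γ : ℝ) :
    (deviation p v).eval γ = ∑ m ∈ Finset.Ico 1 p, v m * γ ^ m := by
  simp [deviation, eval_finsetSum]

theorem sum_mul_pow_isBigO (p : ℕ) (v : ℕ → ℝ) :
    (fun γ : ℝ => ∑ m ∈ Finset.Ico 1 p, v m * γ ^ m) =O[𝓝 0] fun γ => γ := by
  refine IsBigO.fun_sum fun m hm => ?_
  refine IsBigO.const_mul_left ?_ _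
  obtain ⟨k, rfl⟩ : ∃ k, m = k + 1 := ⟨m - 1, by have := (Finset.mem_Ico.1 hm).1; omega⟩
  have : (fun γ : ℝ => γ ^ k * γ) =O[𝓝 0] fun γ => 1 * γ := by
    refine IsBigO.mul ?_ (isBigO_refl _ _)
    exact ((continuous_pow k).tendsto (0 : ℝ)).isBigO_one ℝ
  simpa [pow_succ] using this

theorem sum_mul_pow_tendsto (p : ℕ) (v : ℕ → ℝ) :
    Tendsto (fun γ : ℝ => ∑ m ∈ Finset.Ico 1 p, v m * γ ^ m) (𝓝 0) (𝓝 0) :=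
  (sum_mul_pow_isBigO p v).trans_tendsto tendsto_id

theorem apply_add_eval_deviation (p : ℕ) (H : ℝ → ℝ) (c : ℝ) (v : ℕ → ℝ) (γ : ℝ) :
    H (c + (deviation p v).eval γ) =
      (jet p H c v).eval γ + taylorRemainder p H c ((deviation p v).eval γ) := by
  simp [jet, taylorRemainder, eval_finsetSum]

theorem apply_sub_eval_jet_isBigO (p : ℕ) {H : ℝ → ℝ} (hH : ContDiff ℝ ∞ H) (c : ℝ) (v : ℕ → ℝ) :
    (fun γ : ℝ => H (c + (deviation p v).eval γ) - (jet p H c v).eval γ)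
      =O[𝓝 0] fun γ => γ ^ p := by
  simp only [apply_add_eval_deviation p H c v, add_sub_cancel_left]
  simp only [eval_deviation]
  exact ((taylorRemainder_isBigO p hH c).comp_tendsto (sum_mul_pow_tendsto p v)).trans
    ((sum_mul_pow_isBigO p v).pow p)

theorem natDegree_jet_lt (p : ℕ) (H : ℝ → ℝ) (c : ℝ) (v : ℕ → ℝ) :
    (jet p H c v).natDegree < p * p + 1 := by
  have h1 : (deviation p v).natDegree ≤ p := by
    refine natDegree_sum_le_of_forall_le _ _ fun m hm => ?_
    exact (natDegree_C_mul_X_pow_le _ _).trans (Finset.mem_Ico.1 hm).2.le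
  refine Nat.lt_succ_of_le (natDegree_sum_le_of_forall_le _ _ fun j hj => ?_)
  refine (natDegree_C_mul_le _ _).trans (natDegree_pow_le.trans ?_)
  exact Nat.mul_le_mul (Finset.mem_range.1 hj).le h1

theorem eval_jet (p : ℕ) (H : ℝ → ℝ) (c : ℝ) (v : ℕ → ℝ) (γ : ℝ) :
    (jet p H c v).eval γ = ∑ k ∈ Finset.range (p * p + 1), (jet p H c v).coeff k * γ ^ k :=
  eval_eq_sum_range' (natDegree_jet_lt p H c v) γ

theorem contDiffWithinAt_coeff_pow {E : Type*} [NormedAddCommGroup E] [NormedSpace ℝ E]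
    {s : Set E} {x : E} {n : WithTop ℕ∞} {A : E → ℝ[X]}
    (hA : ∀ k, ContDiffWithinAt ℝ n (fun z => (A z).coeff k) s x) (j k : ℕ) :
    ContDiffWithinAt ℝ n (fun z => ((A z) ^ j).coeff k) s x := by
  induction j generalizing k with
  | zero => simpa only [pow_zero] using contDiffWithinAt_const
  | succ j ih =>
    simp only [pow_succ, coeff_mul]
    exact ContDiffWithinAt.sum fun i _ => (ih _).mul (hA _)

theorem contDiffWithinAt_coeff_jet {E : Type*} [NormedAddCommGroup E] [NormedSpace ℝ E]
    {s : Set E} {x : E} {p n : ℕ} {H : ℝ → ℝ} (hH : ContDiff ℝ ∞ H) {c : E → ℝ} {v : E → ℕ → ℝ}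
    (hc : ContDiffWithinAt ℝ n c s x)
    (hv : ∀ m ∈ Finset.Ico 1 p, ContDiffWithinAt ℝ n (fun z => v z m) s x) (k : ℕ) :
    ContDiffWithinAt ℝ n (fun z => (jet p H (c z) (v z)).coeff k) s x := by
  simp only [jet, finsetSum_coeff, coeff_C_mul]
  refine ContDiffWithinAt.sum fun j _ =>
    ContDiffWithinAt.mul (ContDiffWithinAt.div_const ?_ _) ?_
  · have h1 : ContDiff ℝ ∞ (iteratedDeriv j H) := by
      rw [iteratedDeriv_eq_iterate]
      exact hH.iterate_deriv j
    have h2 : ContDiff ℝ n (iteratedDeriv j H) := contDiff_infty.1 h1 n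
    exact h2.contDiffAt.comp_contDiffWithinAt x hc
  · refine contDiffWithinAt_coeff_pow (fun k => ?_) j k
    simp only [deviation, finsetSum_coeff, coeff_C_mul]
    exact ContDiffWithinAt.sum fun m hm => (hv m hm).mul contDiffWithinAt_const

/-- The expansion in powers of `γ` may be differentiated twice with respect to a parameter on
which the coefficients of the deviation depend: the derivatives of the Taylor remainder lose
powers of the deviation, but each of them yields a factor that is itself `O(γ)`. -/
theorem iteratedDeriv_two_apply_sub_isBigO (p : ℕ) {H : ℝ → ℝ} (hH : ContDiff ℝ ∞ H) (c : ℝ)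
    {V : ℕ → ℝ → ℝ} {x : ℝ} (hV : ∀ m ∈ Finset.Ico 1 p, ContDiffAt ℝ 2 (V m) x) :
    (fun γ : ℝ => iteratedDeriv 2 (fun y => H (c + (deviation p fun m => V m y).eval γ)) x -
        ∑ k ∈ Finset.range (p * p + 1),
          iteratedDeriv 2 (fun y => (jet p H c fun m => V m y).coeff k) x * γ ^ k)
      =O[𝓝 0] fun γ => γ ^ p := by
  have hD : ∀ γ : ℝ, ContDiffAt ℝ 2 (fun y => ∑ m ∈ Finset.Ico 1 p, V m y * γ ^ m) x := fun γ =>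
    ContDiffAt.sum fun m hm => (hV m hm).mul contDiffAt_const
  have hJ : ∀ k, ContDiffAt ℝ 2 (fun y => (jet p H c fun m => V m y).coeff k) x := by
    intro k
    rw [← contDiffWithinAt_univ]
    exact contDiffWithinAt_coeff_jet (n := 2) hH contDiffWithinAt_const
      (fun m hm => (hV m hm).contDiffWithinAt) k
  have hQ := hasDerivAt_taylorRemainder p hH c
  have hH' := (contDiff_infty_iff_deriv.1 hH).2
  have hH'' := (contDiff_infty_iff_deriv.1 hH').2
  have hQ₁ := hasDerivAt_taylorRemainder (p - 1) hH' c
  have key : ∀ γ : ℝ, iteratedDeriv 2 (fun y => H (c + (deviation p fun m => V m y).eval γ)) x -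
        ∑ k ∈ Finset.range (p * p + 1),
          iteratedDeriv 2 (fun y => (jet p H c fun m => V m y).coeff k) x * γ ^ k =
      taylorRemainder (p - 1 - 1) (deriv (deriv H)) c (∑ m ∈ Finset.Ico 1 p, V m x * γ ^ m) *
          (∑ m ∈ Finset.Ico 1 p, deriv (V m) x * γ ^ m) ^ 2 +
        taylorRemainder (p - 1) (deriv H) c (∑ m ∈ Finset.Ico 1 p, V m x * γ ^ m) *
          ∑ m ∈ Finset.Ico 1 p, iteratedDeriv 2 (V m) x * γ ^ m := by
    intro γ
    have e₁ : deriv (fun y => ∑ m ∈ Finset.Ico 1 p, V m y * γ ^ m) x =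
        ∑ m ∈ Finset.Ico 1 p, deriv (V m) x * γ ^ m :=
      (HasDerivAt.fun_sum fun m hm =>
        ((hV m hm).differentiableAt (by norm_num)).hasDerivAt.mul_const _).deriv
    have e₂ : iteratedDeriv 2 (fun y => ∑ m ∈ Finset.Ico 1 p, V m y * γ ^ m) x =
        ∑ m ∈ Finset.Ico 1 p, iteratedDeriv 2 (V m) x * γ ^ m := by
      rw [iteratedDeriv_fun_sum fun m hm => (hV m hm).mul contDiffAt_const]
      refine Finset.sum_congr rfl fun m _ => ?_
      simp only [mul_comm _ (γ ^ m)]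
      exact iteratedDeriv_const_mul_field _ _
    rw [← e₁, ← e₂, ← iteratedDeriv_two_comp hQ hQ₁ (hD γ)]
    simp only [apply_add_eval_deviation, eval_jet]
    simp only [eval_deviation]
    have hR : ContDiffAt ℝ 2
        (fun y => taylorRemainder p H c (∑ m ∈ Finset.Ico 1 p, V m y * γ ^ m)) x := by
      have : ContDiff ℝ 2 (taylorRemainder p H c) := by
        have := contDiff_infty.1 hH 2
        unfold taylorRemainder
        fun_prop
      exact this.contDiffAt.comp x (hD γ)
    rw [iteratedDeriv_fun_add
      (ContDiffAt.sum fun k _ => (hJ k).mul contDiffAt_const) hR,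
      iteratedDeriv_fun_sum fun k _ => (hJ k).mul contDiffAt_const]
    simp only [mul_comm _ (γ ^ _), iteratedDeriv_const_mul_field]
    ring
  simp only [key]
  have hT := sum_mul_pow_tendsto p fun m => V m x
  have hO := sum_mul_pow_isBigO p fun m => V m x
  have hone : ∀ {a b : ℕ}, b ≤ a → (fun γ : ℝ => γ ^ a) =O[𝓝 0] fun γ => γ ^ b :=
    fun hab => IsBigO.of_bound 1 (by
      filter_upwards [Metric.ball_mem_nhds (0 : ℝ) one_pos] with γ hγ
      rw [mem_ball_zero_iff] at hγ
      rw [one_mul, norm_pow, norm_pow]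
      exact pow_le_pow_of_le_one (norm_nonneg _) hγ.le hab)
  refine IsBigO.add ?_ ?_
  · refine ((((taylorRemainder_isBigO (p - 1 - 1) hH'' c).comp_tendsto hT).trans
      (hO.pow _)).mul ((sum_mul_pow_isBigO p fun m => deriv (V m) x).pow 2)).trans ?_
    simp only [← pow_add]
    exact hone (by omega)
  · refine ((((taylorRemainder_isBigO (p - 1) hH' c).comp_tendsto hT).trans
      (hO.pow _)).mul (sum_mul_pow_isBigO p fun m => iteratedDeriv 2 (V m) x)).trans ?_
    simp only [← pow_succ]
    exact hone (by omega)

/-- The first coefficient to which the deviation contributes, it contributes to linearly. -/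
theorem coeff_jet_of_eq_zero {p l : ℕ} (H : ℝ → ℝ) (c : ℝ) {v : ℕ → ℝ} (hl : 1 ≤ l) (hlp : l < p)
    (hv : ∀ m ∈ Finset.Ico 1 l, v m = 0) : (jet p H c v).coeff l = deriv H c * v l := by
  have hdvd : X ^ l ∣ deviation p v := by
    refine Finset.dvd_sum fun m hm => ?_
    by_cases h : m < l
    · rw [hv m (Finset.mem_Ico.2 ⟨(Finset.mem_Ico.1 hm).1, h⟩)]
      simp
    · exact (pow_dvd_pow X (not_lt.1 h)).mul_left _
  have hcoeff : (deviation p v).coeff l = v l := by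
    rw [deviation, finsetSum_coeff, Finset.sum_eq_single l]
    · simp
    · intro m _ hm
      rw [coeff_C_mul, coeff_X_pow, if_neg (Ne.symm hm), mul_zero]
    · exact fun h => absurd (Finset.mem_Ico.2 ⟨hl, hlp⟩) h
  rw [jet, finsetSum_coeff, Finset.sum_eq_single 1]
  · simp [hcoeff]
  · intro j _ hj
    rw [coeff_C_mul]
    rcases Nat.eq_zero_or_pos j with rfl | hj0
    · rw [pow_zero, coeff_one, if_neg (by omega), mul_zero]
    · have h2 : X ^ (l * j) ∣ deviation p v ^ j := by
        rw [pow_mul]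
        exact pow_dvd_pow_of_dvd hdvd j
      rw [(X_pow_dvd_iff.1 h2) l (by nlinarith [show 2 ≤ j by omega]), mul_zero]
  · exact fun h => absurd (Finset.mem_range.2 (by omega)) h

theorem coeff_zero_jet {p : ℕ} (hp : 0 < p) (H : ℝ → ℝ) (c : ℝ) (v : ℕ → ℝ) :
    (jet p H c v).coeff 0 = H c := by
  have h0 : (deviation p v).eval 0 = 0 := by
    rw [eval_deviation]
    exact Finset.sum_eq_zero fun m hm => by
      rw [zero_pow (by have := (Finset.mem_Ico.1 hm).1; omega), mul_zero]
  rw [coeff_zero_eq_eval_zero]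
  have := apply_add_eval_deviation p H c v 0
  have hT : taylorRemainder p H c 0 = 0 := by
    obtain ⟨p, rfl⟩ : ∃ q, p = q + 1 := ⟨p - 1, by omega⟩
    simp [taylorRemainder, Finset.sum_range_succ']
  rw [h0, hT] at this
  simpa using this.symm

theorem coeff_jet_of_eventually_const {p k : ℕ} {H : ℝ → ℝ} {c : ℝ} (hk : 1 ≤ k)
    (hH : deriv H =ᶠ[𝓝 c] 0) (v : ℕ → ℝ) : (jet p H c v).coeff k = 0 := by
  rw [jet, finsetSum_coeff]
  refine Finset.sum_eq_zero fun j _ => ?_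
  rw [coeff_C_mul]
  cases j with
  | zero => rw [pow_zero, coeff_one, if_neg (by omega), mul_zero]
  | succ j =>
    rw [iteratedDeriv_succ', EventuallyEq.iteratedDeriv_eq j hH]
    have : iteratedDeriv j (0 : ℝ → ℝ) c = 0 := iteratedDeriv_fun_const_zero
    simp [this]

variable {p r : ℕ}

theorem coeff_deviation {p m : ℕ} (v : ℕ → ℝ) (hm : m ∈ Finset.Ico 1 p) :
    (deviation p v).coeff m = v m := by
  rw [deviation, finsetSum_coeff, Finset.sum_eq_single m]
  · simp
  · intro k _ hk
    rw [coeff_C_mul, coeff_X_pow, if_neg (Ne.symm hk), mul_zero]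
  · exact fun h => absurd hm h

/-! ### The model in terms of coefficients -/

/-- The index of the central entry of a stencil. -/
def center (r : ℕ) : Fin (2 * r + 1) := ⟨r, by omega⟩

@[simp]
theorem stencil_center (r : ℕ) (U : ℤ → ℝ) (i : ℤ) : stencil r U i (center r) = U i := by
  simp [stencil, center]

/-- Arbitrary stencil values extend to a grid function, constant away from the stencil. -/
theorem exists_stencil_eq {I : Set ℝ} {w : Fin (2 * r + 1) → ℝ} (hw : w ∈ univ.pi fun _ => I) :
    ∃ U : ℤ → ℝ, (∀ j, U j ∈ I) ∧ stencil r U 0 = w := by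
  refine ⟨fun j => w ⟨min (j + r).toNat (2 * r), by omega⟩, fun j => hw _ (mem_univ _), ?_⟩
  ext j
  simp only [stencil]
  congr 1
  ext
  have := j.2
  simp
  omega

theorem stencil_mem_pi {I : Set ℝ} {U : ℤ → ℝ} (hU : ∀ j, U j ∈ I) (i : ℤ) :
    stencil r U i ∈ univ.pi fun _ => I := fun _ _ => hU _

theorem evenOperator_of_natDegree_eq_one {a : ℝ[X]} (ha : a.natDegree = 1) (f : ℝ → ℝ) (x : ℝ) :
    evenOperator a f x = a.coeff 0 * f x + a.coeff 1 * iteratedDeriv 2 f x := by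
  rw [evenOperator, sum_over_range' _ (by simp) 2 (by omega)]
  simp [Finset.sum_range_succ]

/-- The set of positions, stencil values and spacings on which the subgrid fields are regular. -/
def domain (r : ℕ) (I : Set ℝ) (h₀ : ℝ) : Set (ℝ × (Fin (2 * r + 1) → ℝ) × ℝ) :=
  Icc (-1) 1 ×ˢ (univ.pi fun _ => I) ×ˢ Ico 0 h₀

/-- The coefficient of `γ ^ k` in the subgrid field, extended by zero to all `k : ℕ`. -/
noncomputable def Model.fieldCoeff (M : Model p r) (k : ℕ)
    (z : ℝ × (Fin (2 * r + 1) → ℝ) × ℝ) : ℝ :=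
  if hk : k < p then M.field ⟨k, hk⟩ z.1 z.2.1 z.2.2 else 0

/-- The coefficient of `γ ^ k` in the evolution law, extended by zero to all `k : ℕ`. -/
noncomputable def Model.rateCoeff (M : Model p r) (k : ℕ) (w : Fin (2 * r + 1) → ℝ) (h : ℝ) : ℝ :=
  if hk : k < p then M.rate ⟨k, hk⟩ w h else 0

/-- The coefficient of `γ ^ k` in `H (v)`, for the subgrid field `v`; meaningful for `k < p`. The
expansion is about the central grid value, which is the leading coefficient of `v` for `h > 0`. -/
noncomputable def Model.jetCoeff (M : Model p r) (H : ℝ → ℝ) (k : ℕ)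
    (z : ℝ × (Fin (2 * r + 1) → ℝ) × ℝ) : ℝ :=
  (jet p H (z.2.1 (center r)) fun m => M.fieldCoeff m z).coeff k

/-- The derivative of the subgrid coefficient `k` with respect to the stencil values. -/
noncomputable def Model.fieldDeriv (M : Model p r) (k : ℕ)
    (z : ℝ × (Fin (2 * r + 1) → ℝ) × ℝ) : (Fin (2 * r + 1) → ℝ) →L[ℝ] ℝ :=
  fderiv ℝ (fun w => M.fieldCoeff k (z.1, w, z.2.2)) z.2.1

/-- The coefficients of the evolution law at the points of a stencil. -/
noncomputable def Model.rateStencil (M : Model p r) (k : ℕ) (h : ℝ) (U : ℤ → ℝ) (i : ℤ) :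
    Fin (2 * r + 1) → ℝ :=
  stencil r (fun j => M.rateCoeff k (stencil r U j) h) i

/-- The arguments of the subgrid coefficients at the point `x` of the `i`-th element. -/
noncomputable def localPoint (r : ℕ) (h : ℝ) (U : ℤ → ℝ) (i : ℤ) (x : ℝ) :
    ℝ × (Fin (2 * r + 1) → ℝ) × ℝ :=
  ((x - gridPoint h i) / h, stencil r U i, h)

theorem gridPoint_add (h : ℝ) (i j : ℤ) :
    gridPoint h (i + j) = gridPoint h i + j * h := by
  simp [gridPoint]
  ring

theorem gridPoint_succ (h : ℝ) (i : ℤ) : gridPoint h (i + 1) = gridPoint h i + h := by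
  simp [gridPoint]
  ring

theorem gridPoint_pred (h : ℝ) (i : ℤ) : gridPoint h (i - 1) = gridPoint h i - h := by
  simp [gridPoint]
  ring

theorem div_mem_Icc {x X h : ℝ} (hh : 0 < h) (hx : x ∈ Icc (X - h) (X + h)) :
    (x - X) / h ∈ Icc (-1 : ℝ) 1 := by
  constructor
  · rw [le_div_iff₀ hh]; linarith [hx.1]
  · rw [div_le_iff₀ hh]; linarith [hx.2]

theorem Model.subgrid_eq_sum (M : Model p r) (h γ : ℝ) (U : ℤ → ℝ) (i : ℤ) (x : ℝ) :
    M.subgrid h γ U i x =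
      ∑ k ∈ Finset.range p, M.fieldCoeff k (localPoint r h U i x) * γ ^ k := by
  rw [subgrid, ← Fin.sum_univ_eq_sum_range
    (fun k => M.fieldCoeff k (localPoint r h U i x) * γ ^ k)]
  refine Finset.sum_congr rfl fun k _ => ?_
  simp [fieldCoeff, localPoint, mul_comm]

theorem Model.evolution_eq_sum (M : Model p r) (h γ : ℝ) (U : ℤ → ℝ) (i : ℤ) :
    M.evolution h γ U i = ∑ k ∈ Finset.range p, M.rateCoeff k (stencil r U i) h * γ ^ k := by
  rw [evolution, ← Fin.sum_univ_eq_sum_range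
    (fun k => M.rateCoeff k (stencil r U i) h * γ ^ k)]
  refine Finset.sum_congr rfl fun k _ => ?_
  simp [rateCoeff, mul_comm]

theorem Model.subgridTimeDeriv_eq_sum (M : Model p r) (h γ : ℝ) (U : ℤ → ℝ) (i : ℤ) (x : ℝ) :
    M.subgridTimeDeriv h γ U i x =
      ∑ k ∈ Finset.range p, ∑ l ∈ Finset.range p,
        M.fieldDeriv k (localPoint r h U i x) (M.rateStencil l h U i) * γ ^ (k + l) := by
  have hst : stencil r (M.evolution h γ U) i =
      ∑ l ∈ Finset.range p, γ ^ l • M.rateStencil l h U i := by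
    ext j
    simp [stencil, Model.evolution_eq_sum, rateStencil, Finset.sum_apply, mul_comm]
  rw [subgridTimeDeriv, ← Fin.sum_univ_eq_sum_range
    (fun k => ∑ l ∈ Finset.range p,
        M.fieldDeriv k (localPoint r h U i x) (M.rateStencil l h U i) * γ ^ (k + l))]
  refine Finset.sum_congr rfl fun k _ => ?_
  rw [hst, map_sum, Finset.mul_sum]
  refine Finset.sum_congr rfl fun l _ => ?_
  simp only [fieldDeriv, fieldCoeff, localPoint, k.2, dite_true, map_smul, smul_eq_mul, pow_add]
  ring

theorem Model.contDiffOn_fieldCoeff {M : Model p r} {a : ℝ[X]} {F g : ℝ → ℝ} {I : Set ℝ} {h₀ : ℝ}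
    (hM : M.IsSlowManifold a F g I h₀) (k : ℕ) :
    ContDiffOn ℝ 2 (M.fieldCoeff k) (domain r I h₀) := by
  by_cases hk : k < p
  · have := hM.smooth ⟨k, hk⟩
    unfold fieldCoeff
    simp only [hk, dite_true]
    exact this
  · unfold fieldCoeff
    simpa only [hk, dite_false] using contDiffOn_const

theorem Model.fieldCoeff_zero {M : Model p r} {a : ℝ[X]} {F g : ℝ → ℝ} {I : Set ℝ} {h₀ : ℝ}
    (hM : M.IsSlowManifold a F g I h₀) (hp : 0 < p) {ξ h : ℝ} {w : Fin (2 * r + 1) → ℝ}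
    (hξ : ξ ∈ Icc (-1) 1) (hw : w ∈ univ.pi fun _ => I) (hh : h ∈ Ioo 0 h₀) :
    M.fieldCoeff 0 (ξ, w, h) = w (center r) := by
  obtain ⟨U, hU, rfl⟩ := exists_stencil_eq hw
  have := hM.base h hh U hU 0 (ξ * h) (by
    constructor
    · simp [gridPoint]; nlinarith [hξ.1, hh.1]
    · simp [gridPoint]; nlinarith [hξ.2, hh.1])
  rw [subgrid_eq_sum, Finset.sum_eq_single_of_mem 0 (Finset.mem_range.2 hp)] at this
  · have e : (ξ * h - gridPoint h 0) / h = ξ := by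
      rw [gridPoint]; field_simp [hh.1.ne']; simp
    simpa [localPoint, e] using this
  · intro k _ hk
    rw [zero_pow hk, mul_zero]

theorem Model.fieldCoeff_at_zero {M : Model p r} {a : ℝ[X]} {F g : ℝ → ℝ} {I : Set ℝ} {h₀ : ℝ}
    (hM : M.IsSlowManifold a F g I h₀) {m : ℕ} (hm : m ∈ Finset.Ico 1 p) {h : ℝ}
    {w : Fin (2 * r + 1) → ℝ} (hw : w ∈ univ.pi fun _ => I) (hh : h ∈ Ioo 0 h₀) :
    M.fieldCoeff m (0, w, h) = 0 := by
  obtain ⟨U, hU, rfl⟩ := exists_stencil_eq hw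
  have hp : 0 < p := by have := Finset.mem_Ico.1 hm; omega
  rw [← coeff_deviation (fun m => M.fieldCoeff m (0, stencil r U 0, h)) hm]
  refine coeff_eq_zero_of_eval_isBigO (p := p) ?_ (Finset.mem_Ico.1 hm).2
  have : (fun γ : ℝ => (deviation p fun m => M.fieldCoeff m (0, stencil r U 0, h)).eval γ) =
      fun _ => 0 := by
    ext γ
    have h1 := hM.amplitude h hh U hU 0 γ
    rw [subgrid_eq_sum, Finset.range_eq_Ico, Finset.sum_eq_sum_Ico_succ_bot hp] at h1
    simp only [localPoint, sub_self, zero_div] at h1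
    rw [fieldCoeff_zero hM hp (by simp) hw hh] at h1
    rw [eval_deviation]
    simpa using h1
  rw [this]
  exact isBigO_zero _ _

theorem Model.subgrid_eq_add_eval {M : Model p r} {a : ℝ[X]} {F g : ℝ → ℝ} {I : Set ℝ} {h₀ : ℝ}
    (hM : M.IsSlowManifold a F g I h₀) (hp : 0 < p) {h : ℝ} (hh : h ∈ Ioo 0 h₀) {U : ℤ → ℝ}
    (hU : ∀ j, U j ∈ I) (i : ℤ) {x : ℝ} (hx : x ∈ Icc (gridPoint h i - h) (gridPoint h i + h))
    (γ : ℝ) :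
    M.subgrid h γ U i x =
      U i + (deviation p fun m => M.fieldCoeff m (localPoint r h U i x)).eval γ := by
  rw [subgrid_eq_sum, Finset.range_eq_Ico, Finset.sum_eq_sum_Ico_succ_bot hp, eval_deviation]
  congr 1
  rw [localPoint, fieldCoeff_zero hM hp (div_mem_Icc hh.1 hx) (stencil_mem_pi hU i) hh]
  simp

theorem localPoint_mem_domain {I : Set ℝ} {h₀ h : ℝ} (hh : h ∈ Ioo 0 h₀) {U : ℤ → ℝ}
    (hU : ∀ j, U j ∈ I) (i : ℤ) {x : ℝ} (hx : x ∈ Icc (gridPoint h i - h) (gridPoint h i + h)) :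
    localPoint r h U i x ∈ domain r I h₀ :=
  ⟨div_mem_Icc hh.1 hx, stencil_mem_pi hU i, hh.1.le, hh.2⟩

theorem Model.contDiffOn_jetCoeff {M : Model p r} {a : ℝ[X]} {F g : ℝ → ℝ} {I : Set ℝ} {h₀ : ℝ}
    (hM : M.IsSlowManifold a F g I h₀) {H : ℝ → ℝ} (hH : ContDiff ℝ ∞ H) (k : ℕ) :
    ContDiffOn ℝ 2 (M.jetCoeff H k) (domain r I h₀) := fun z hz =>
  contDiffWithinAt_coeff_jet (n := 2) hH
    (c := fun z : ℝ × (Fin (2 * r + 1) → ℝ) × ℝ => z.2.1 (center r))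
    ((contDiff_apply ℝ ℝ (center r)).comp (contDiff_fst.comp contDiff_snd)).contDiffWithinAt
    (fun m _ => contDiffOn_fieldCoeff hM m z hz) k

theorem contDiffOn_comp_localPoint {φ : ℝ × (Fin (2 * r + 1) → ℝ) × ℝ → ℝ} {I : Set ℝ} {h₀ h : ℝ}
    (hφ : ContDiffOn ℝ 2 φ (domain r I h₀)) (hh : h ∈ Ioo 0 h₀) {U : ℤ → ℝ}
    (hU : ∀ j, U j ∈ I) (i : ℤ) :
    ContDiffOn ℝ 2 (fun x => φ (localPoint r h U i x))
      (Icc (gridPoint h i - h) (gridPoint h i + h)) := by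
  refine hφ.comp (ContDiff.contDiffOn ?_) fun x hx => localPoint_mem_domain hh hU i hx
  unfold localPoint
  fun_prop

/-! ### The residuals of the PDE and of the coupling conditions, order by order -/

/-- The coefficient of `γ ^ k` in the residual of the PDE vanishes. -/
theorem Model.sum_antidiagonal_fieldDeriv {M : Model p r} {a : ℝ[X]} (ha : a.natDegree = 1)
    {F g : ℝ → ℝ} (hF : ContDiff ℝ ∞ F) (hg : ContDiff ℝ ∞ g) {I : Set ℝ} {h₀ : ℝ}
    (hM : M.IsSlowManifold a F g I h₀) {k : ℕ} (hk : k < p) {h : ℝ} (hh : h ∈ Ioo 0 h₀)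
    {U : ℤ → ℝ} (hU : ∀ j, U j ∈ I) (i : ℤ) {x : ℝ}
    (hx : x ∈ Ioo (gridPoint h i - h) (gridPoint h i + h)) :
    ∑ q ∈ Finset.HasAntidiagonal.antidiagonal k,
        M.fieldDeriv q.1 (localPoint r h U i x) (M.rateStencil q.2 h U i) =
      a.coeff 0 * M.jetCoeff F k (localPoint r h U i x) +
        a.coeff 1 * iteratedDeriv 2 (fun y => M.jetCoeff F k (localPoint r h U i y)) x +
        M.jetCoeff g k (localPoint r h U i x) := by
  have hp : 0 < p := by omega
  have hxI := Ioo_subset_Icc_self hx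
  have hnhds : Icc (gridPoint h i - h) (gridPoint h i + h) ∈ 𝓝 x := Icc_mem_nhds hx.1 hx.2
  have hpde := hM.pde h hh U hU i x (by rwa [gridPoint_pred, gridPoint_succ])
  set B := p * p + 1
  set z := localPoint r h U i x with hz
  have hFO := apply_sub_eval_jet_isBigO p hF (U i) fun m => M.fieldCoeff m z
  have hgO := apply_sub_eval_jet_isBigO p hg (U i) fun m => M.fieldCoeff m z
  have hDO := iteratedDeriv_two_apply_sub_isBigO p hF (U i)
    (V := fun m y => M.fieldCoeff m (localPoint r h U i y)) (x := x) fun m _ =>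
      (contDiffOn_comp_localPoint (contDiffOn_fieldCoeff hM m) hh hU i).contDiffAt hnhds
  have hjet : ∀ H y k, M.jetCoeff H k (localPoint r h U i y) =
      (jet p H (U i) fun m => M.fieldCoeff m (localPoint r h U i y)).coeff k := by
    intro H y k
    simp [jetCoeff, localPoint]
  have hsum := ((hpde.add (hFO.const_mul_left (a.coeff 0))).add
    (hDO.const_mul_left (a.coeff 1))).add hgO
  set P : ℝ[X] := ∑ k ∈ Finset.range p, ∑ l ∈ Finset.range p,
    C (M.fieldDeriv k z (M.rateStencil l h U i)) * X ^ (k + l) with hP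
  set Q : ℝ[X] := P - (C (a.coeff 0) * jet p F (U i) (fun m => M.fieldCoeff m z) +
    C (a.coeff 1) * ∑ k ∈ Finset.range B,
      C (iteratedDeriv 2 (fun y => M.jetCoeff F k (localPoint r h U i y)) x) * X ^ k +
    jet p g (U i) (fun m => M.fieldCoeff m z)) with hQ
  have hQO : (fun γ : ℝ => Q.eval γ) =O[𝓝 0] fun γ => γ ^ p := by
    refine hsum.congr_left fun γ => ?_
    have e₁ : iteratedDeriv 2 (fun y => F (M.subgrid h γ U i y)) x = iteratedDeriv 2
        (fun y => F (U i +
          (deviation p fun m => M.fieldCoeff m (localPoint r h U i y)).eval γ)) x := by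
      refine EventuallyEq.iteratedDeriv_eq 2 ?_
      filter_upwards [hnhds] with y hy
      rw [subgrid_eq_add_eval hM hp hh hU i hy]
    rw [evenOperator_of_natDegree_eq_one ha, e₁, subgrid_eq_add_eval hM hp hh hU i hxI,
      subgridTimeDeriv_eq_sum]
    simp only [hQ, hP, hjet, eval_sub, eval_add, eval_mul, eval_C, eval_finsetSum, eval_pow,
      eval_X]
    ring
  have hcoeff := coeff_eq_zero_of_eval_isBigO (hQO.mono nhdsWithin_le_nhds) hk
  have hPc : P.coeff k = ∑ q ∈ Finset.HasAntidiagonal.antidiagonal k,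
      M.fieldDeriv q.1 z (M.rateStencil q.2 h U i) := by
    have hfilter : (Finset.range p ×ˢ Finset.range p).filter (fun q => k = q.1 + q.2) =
        Finset.HasAntidiagonal.antidiagonal k := by
      ext q
      simp only [Finset.mem_filter, Finset.mem_product, Finset.mem_range,
        Finset.HasAntidiagonal.mem_antidiagonal]
      omega
    rw [hP, ← Finset.sum_product', finsetSum_coeff, ← hfilter, Finset.sum_filter]
    refine Finset.sum_congr rfl fun q _ => ?_
    rw [coeff_C_mul, coeff_X_pow]
    split_ifs <;> simp
  have hDc : (∑ k ∈ Finset.range B,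
      C (iteratedDeriv 2 (fun y => M.jetCoeff F k (localPoint r h U i y)) x) * X ^ k).coeff k =
      iteratedDeriv 2 (fun y => M.jetCoeff F k (localPoint r h U i y)) x := by
    rw [finsetSum_coeff, Finset.sum_eq_single_of_mem k (Finset.mem_range.2 (by
      have : p ≤ p * p := Nat.le_mul_self p
      omega))]
    · simp
    · intro j _ hj
      rw [coeff_C_mul, coeff_X_pow, if_neg (Ne.symm hj), mul_zero]
  rw [hQ, coeff_sub, coeff_add, coeff_add, coeff_C_mul, coeff_C_mul, hDc, hPc] at hcoeff
  rw [hjet F x, hjet g x, ← hz]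
  linarith

theorem Model.fieldDeriv_zero {M : Model p r} {a : ℝ[X]} {F g : ℝ → ℝ} {I : Set ℝ} (hI : IsOpen I)
    {h₀ : ℝ} (hM : M.IsSlowManifold a F g I h₀) (hp : 0 < p) {ξ h : ℝ} {w : Fin (2 * r + 1) → ℝ}
    (hξ : ξ ∈ Icc (-1) 1) (hw : w ∈ univ.pi fun _ => I) (hh : h ∈ Ioo 0 h₀)
    (v : Fin (2 * r + 1) → ℝ) : M.fieldDeriv 0 (ξ, w, h) v = v (center r) := by
  have : (fun w => M.fieldCoeff 0 (ξ, w, h)) =ᶠ[𝓝 w] fun w => w (center r) := by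
    filter_upwards [(isOpen_set_pi finite_univ fun _ _ => hI).mem_nhds hw] with w hw
    exact fieldCoeff_zero hM hp hξ hw hh
  rw [fieldDeriv, this.fderiv_eq]
  have h2 : HasFDerivAt (fun w : Fin (2 * r + 1) → ℝ => w (center r))
    (ContinuousLinearMap.proj (R := ℝ) (φ := fun _ : Fin (2 * r + 1) => ℝ) (center r)) w :=
    hasFDerivAt_apply _ _
  rw [h2.fderiv]
  rfl

theorem Model.fieldDeriv_at_zero {M : Model p r} {a : ℝ[X]} {F g : ℝ → ℝ} {I : Set ℝ}
    (hI : IsOpen I) {h₀ : ℝ} (hM : M.IsSlowManifold a F g I h₀) {m : ℕ} (hm : m ∈ Finset.Ico 1 p)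
    {h : ℝ} {w : Fin (2 * r + 1) → ℝ} (hw : w ∈ univ.pi fun _ => I) (hh : h ∈ Ioo 0 h₀) :
    M.fieldDeriv m (0, w, h) = 0 := by
  have : (fun w => M.fieldCoeff m (0, w, h)) =ᶠ[𝓝 w] fun _ => 0 := by
    filter_upwards [(isOpen_set_pi finite_univ fun _ _ => hI).mem_nhds hw] with w hw
    exact fieldCoeff_at_zero hM hm hw hh
  rw [fieldDeriv, this.fderiv_eq]
  simp

/-- The coefficient of `γ ^ k` in the coupling conditions. -/
theorem Model.jetCoeff_of_coupling {M : Model p r} {a : ℝ[X]} {F g : ℝ → ℝ} (hF : ContDiff ℝ ∞ F)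
    {I : Set ℝ} {h₀ : ℝ} (hM : M.IsSlowManifold a F g I h₀) {k : ℕ} (hk : k ∈ Finset.Ico 1 p)
    {h : ℝ} (hh : h ∈ Ioo 0 h₀) {U : ℤ → ℝ} (hU : ∀ j, U j ∈ I) (i : ℤ) {s : ℤ}
    (hs : s = 1 ∨ s = -1) :
    M.jetCoeff F k (localPoint r h U i (gridPoint h (i + s))) =
      if k = 1 then F (U (i + s)) - F (U i) else 0 := by
  have hk' := Finset.mem_Ico.1 hk
  have hp : 0 < p := by omega
  have hx : gridPoint h (i + s) ∈ Icc (gridPoint h i - h) (gridPoint h i + h) := by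
    rcases hs with rfl | rfl
    · rw [gridPoint_succ]; constructor <;> linarith [hh.1]
    · rw [← sub_eq_add_neg, gridPoint_pred]; constructor <;> linarith [hh.1]
  have hc := hM.coupling h hh U hU i s hs
  set z := localPoint r h U i (gridPoint h (i + s)) with hz
  have hO := apply_sub_eval_jet_isBigO p hF (U i) fun m => M.fieldCoeff m z
  set Q : ℝ[X] := jet p F (U i) (fun m => M.fieldCoeff m z) -
    (C (F (U i)) + C (F (U (i + s)) - F (U i)) * X) with hQ
  have hQO : (fun γ : ℝ => Q.eval γ) =O[𝓝 0] fun γ => γ ^ p := by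
    refine (hc.sub hO).congr_left fun γ => ?_
    rw [hM.amplitude h hh U hU, hM.amplitude h hh U hU, subgrid_eq_add_eval hM hp hh hU i hx]
    simp only [hQ, eval_sub, eval_add, eval_mul, eval_C, eval_X]
    ring
  have hcoeff := coeff_eq_zero_of_eval_isBigO (hQO.mono nhdsWithin_le_nhds) hk'.2
  have e : M.jetCoeff F k z = (jet p F (U i) fun m => M.fieldCoeff m z).coeff k := by
    simp [jetCoeff, hz, localPoint]
  rw [hQ, coeff_sub, coeff_add, coeff_C, if_neg (by omega), coeff_C_mul, coeff_X] at hcoeff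
  rw [e]
  simp only [@eq_comm _ 1 k] at hcoeff
  split_ifs at hcoeff ⊢ <;> linarith

theorem Model.jetCoeff_at_grid {M : Model p r} {a : ℝ[X]} {F g : ℝ → ℝ} {I : Set ℝ} {h₀ : ℝ}
    (hM : M.IsSlowManifold a F g I h₀) {k : ℕ} (hk : k ∈ Finset.Ico 1 p) (H : ℝ → ℝ) {h : ℝ}
    (hh : h ∈ Ioo 0 h₀) {U : ℤ → ℝ} (hU : ∀ j, U j ∈ I) (i : ℤ) :
    M.jetCoeff H k (localPoint r h U i (gridPoint h i)) = 0 := by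
  have hk' := Finset.mem_Ico.1 hk
  have : ∀ m ∈ Finset.Ico 1 p, M.fieldCoeff m (localPoint r h U i (gridPoint h i)) = 0 := by
    intro m hm
    rw [localPoint, sub_self, zero_div]
    exact fieldCoeff_at_zero hM hm (stencil_mem_pi hU i) hh
  rw [jetCoeff, coeff_jet_of_eq_zero _ _ hk'.1 hk'.2, this k hk, mul_zero]
  intro m hm
  exact this m (Finset.Ico_subset_Ico_right hk'.2.le hm)

end Holistic

/-! ### The evolution law in terms of the subgrid fields -/

theorem IsCompact.eventually_forall_of_eventually_prod {ι Y : Type*} [TopologicalSpace Y]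
    {K : Set Y} (hK : IsCompact K) {l : Filter ι} {P : ι → Y → Prop}
    (h : ∀ y ∈ K, ∀ᶠ q in l ×ˢ 𝓝[K] y, P q.1 q.2) : ∀ᶠ a in l, ∀ y ∈ K, P a y := by
  refine hK.induction_on (p := fun S => ∀ᶠ a in l, ∀ y ∈ S, P a y) (by simp) ?_ ?_ ?_
  · exact fun s t hst ht => ht.mono fun a ha y hy => ha y (hst hy)
  · intro s t hs ht
    filter_upwards [hs, ht] with a h₁ h₂ y hy
    exact hy.elim (h₁ y) (h₂ y)
  · intro y hy
    obtain ⟨pa, hpa, pb, hpb, hP⟩ := eventually_prod_iff.1 (h y hy)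
    exact ⟨{y | pb y}, hpb, hpa.mono fun a ha y hy => hP ha hy⟩

theorem tendsto_clm_apply {ι E : Type*} [NormedAddCommGroup E] [NormedSpace ℝ E] {l : Filter ι}
    {L : ι → E →L[ℝ] ℝ} {v : ι → E} {L₀ : E →L[ℝ] ℝ} {v₀ : E} (hL : Tendsto L l (𝓝 L₀))
    (hv : Tendsto v l (𝓝 v₀)) : Tendsto (fun b => L b (v b)) l (𝓝 (L₀ v₀)) :=
  (isBoundedBilinearMap_apply.continuous.tendsto (L₀, v₀)).comp (hL.prodMk_nhds hv)

namespace Holistic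

variable {p r : ℕ}

open Polynomial

/-- The terms of order `γ ^ k` in the residual of the PDE, other than the leading rate and the
second derivative; see `Model.coeff_one_mul_iteratedDeriv_jetCoeff`. -/
noncomputable def Model.remainder (M : Model p r) (a : ℝ[X]) (F g : ℝ → ℝ) (k : ℕ) (h : ℝ)
    (U : ℤ → ℝ) (i : ℤ) (ξ : ℝ) : ℝ :=
  ∑ m ∈ Finset.range k,
      M.fieldDeriv (m + 1) (ξ, stencil r U i, h) (M.rateStencil (k - (m + 1)) h U i) -
    (a.coeff 0 * M.jetCoeff F k (ξ, stencil r U i, h) + M.jetCoeff g k (ξ, stencil r U i, h))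

section Equations

variable {M : Model p r} {a : ℝ[X]} {F g : ℝ → ℝ} {I : Set ℝ} {h₀ : ℝ}

theorem localPoint_add (h : ℝ) (hh : 0 < h) (U : ℤ → ℝ) (i : ℤ) (ξ : ℝ) :
    localPoint r h U i (gridPoint h i + ξ * h) = (ξ, stencil r U i, h) := by
  simp [localPoint, hh.ne']

/-- The PDE at order `γ ^ k`. The leading coefficient of the subgrid field is the grid value, whose
rate of change is the evolution law; it is split off from the sum over the other coefficients. -/
theorem Model.coeff_one_mul_iteratedDeriv_jetCoeff (ha : a.natDegree = 1)
    (hF : ContDiff ℝ ∞ F) (hg : ContDiff ℝ ∞ g) (hI : IsOpen I)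
    (hM : M.IsSlowManifold a F g I h₀) {k : ℕ} (hk : k < p) {h : ℝ} (hh : h ∈ Ioo 0 h₀)
    {U : ℤ → ℝ} (hU : ∀ j, U j ∈ I) (i : ℤ) {x : ℝ}
    (hx : x ∈ Ioo (gridPoint h i - h) (gridPoint h i + h)) :
    a.coeff 1 * iteratedDeriv 2 (fun y => M.jetCoeff F k (localPoint r h U i y)) x =
      M.rateCoeff k (stencil r U i) h +
        M.remainder a F g k h U i ((x - gridPoint h i) / h) := by
  have h1 := sum_antidiagonal_fieldDeriv ha hF hg hM hk hh hU i hx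
  rw [Finset.Nat.sum_antidiagonal_eq_sum_range_succ
    (fun m l => M.fieldDeriv m (localPoint r h U i x) (M.rateStencil l h U i)) k,
    Finset.sum_range_succ'] at h1
  rw [localPoint, fieldDeriv_zero hI hM (by omega) (div_mem_Icc hh.1 (Ioo_subset_Icc_self hx))
    (stencil_mem_pi hU i) hh, rateStencil, stencil_center] at h1
  simp only [Nat.sub_zero] at h1
  rw [remainder]
  linarith

theorem Model.rateCoeff_zero (ha : a.natDegree = 1)
    (hF : ContDiff ℝ ∞ F) (hg : ContDiff ℝ ∞ g) (hI : IsOpen I)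
    (hM : M.IsSlowManifold a F g I h₀) (hp : 0 < p) {h : ℝ} (hh : h ∈ Ioo 0 h₀)
    {U : ℤ → ℝ} (hU : ∀ j, U j ∈ I) (i : ℤ) :
    M.rateCoeff 0 (stencil r U i) h = a.coeff 0 * F (U i) + g (U i) := by
  have hx : gridPoint h i ∈ Ioo (gridPoint h i - h) (gridPoint h i + h) := by
    constructor <;> linarith [hh.1]
  have h1 := coeff_one_mul_iteratedDeriv_jetCoeff ha hF hg hI hM hp hh hU i hx
  have h2 : ∀ H ξ, M.jetCoeff H 0 (ξ, stencil r U i, h) = H (U i) := fun H ξ => by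
    simp only [jetCoeff, coeff_zero_jet hp, stencil_center]
  simp only [remainder, localPoint, h2, Finset.range_zero, Finset.sum_empty] at h1
  rw [iteratedDeriv_succ, iteratedDeriv_one, deriv_const', deriv_const, mul_zero] at h1
  linarith

theorem Model.remainder_at_zero (hI : IsOpen I)
    (hM : M.IsSlowManifold a F g I h₀) {k : ℕ} (hk : k ∈ Finset.Ico 1 p) {h : ℝ}
    (hh : h ∈ Ioo 0 h₀) {U : ℤ → ℝ} (hU : ∀ j, U j ∈ I) (i : ℤ) :
    M.remainder a F g k h U i 0 = 0 := by
  have hk' := Finset.mem_Ico.1 hk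
  have h2 : ∀ H, M.jetCoeff H k (0, stencil r U i, h) = 0 := fun H => by
    simpa [localPoint] using jetCoeff_at_grid hM hk H hh hU i
  rw [remainder, h2, h2, Finset.sum_eq_zero]
  · simp
  · intro m hm
    rw [fieldDeriv_at_zero hI hM (Finset.mem_Ico.2 ⟨by omega, by
      have := Finset.mem_range.1 hm; omega⟩) (stencil_mem_pi hU i) hh]
    rfl

/-- Where `F` is locally constant, there is no coupling between the elements. -/
theorem Model.rateCoeff_of_eventually_const (ha : a.natDegree = 1)
    (hF : ContDiff ℝ ∞ F) (hg : ContDiff ℝ ∞ g) (hI : IsOpen I)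
    (hM : M.IsSlowManifold a F g I h₀) {k : ℕ} (hk : k ∈ Finset.Ico 1 p) {h : ℝ}
    (hh : h ∈ Ioo 0 h₀) {U : ℤ → ℝ} (hU : ∀ j, U j ∈ I) (i : ℤ)
    (hFU : deriv F =ᶠ[𝓝 (U i)] 0) : M.rateCoeff k (stencil r U i) h = 0 := by
  have hk' := Finset.mem_Ico.1 hk
  have hx : gridPoint h i ∈ Ioo (gridPoint h i - h) (gridPoint h i + h) := by
    constructor <;> linarith [hh.1]
  have h1 := coeff_one_mul_iteratedDeriv_jetCoeff ha hF hg hI hM hk'.2 hh hU i hx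
  have h2 : ∀ ξ, M.jetCoeff F k (ξ, stencil r U i, h) = 0 := fun ξ => by
    simp only [jetCoeff, stencil_center]
    exact coeff_jet_of_eventually_const hk'.1 hFU _
  simp only [localPoint, h2, sub_self, zero_div] at h1
  rw [remainder_at_zero hI hM hk hh hU, iteratedDeriv_fun_const_zero] at h1
  linarith

/-- The evolution law is determined by the subgrid field up to the size of the remainder: the
second derivative of `jetCoeff F k` is nearly constant, and its second difference over the element
is known from the coupling conditions. -/
theorem Model.abs_sub_rateCoeff_le (ha : a.natDegree = 1)
    (hF : ContDiff ℝ ∞ F) (hg : ContDiff ℝ ∞ g) (hI : IsOpen I)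
    (hM : M.IsSlowManifold a F g I h₀) {k : ℕ} (hk : k ∈ Finset.Ico 1 p) {h : ℝ}
    (hh : h ∈ Ioo 0 h₀) {U : ℤ → ℝ} (hU : ∀ j, U j ∈ I) (i : ℤ) {ε : ℝ}
    (hε : ∀ ξ ∈ Icc (-1 : ℝ) 1, |M.remainder a F g k h U i ξ| ≤ ε) :
    |a.coeff 1 * (if k = 1 then F (U (i + 1)) + F (U (i - 1)) - 2 * F (U i) else 0) -
      h ^ 2 * M.rateCoeff k (stencil r U i) h| ≤ h ^ 2 * ε := by
  have hφ := (contDiffOn_comp_localPoint (contDiffOn_jetCoeff hM hF k) hh hU i).const_smul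
    (a.coeff 1)
  simp only [smul_eq_mul] at hφ
  have h1 := abs_second_difference_sub_le (A := M.rateCoeff k (stencil r U i) h) (ε := ε)
    hh.1 hφ.continuousOn (fun y hy => hφ.contDiffAt (Icc_mem_nhds hy.1 hy.2)) fun y hy => by
      rw [iteratedDeriv_const_mul_field,
        coeff_one_mul_iteratedDeriv_jetCoeff ha hF hg hI hM (Finset.mem_Ico.1 hk).2 hh hU i hy,
        add_sub_cancel_left]
      exact hε _ (div_mem_Icc hh.1 (Ioo_subset_Icc_self hy))
  rw [← gridPoint_succ, ← gridPoint_pred, sub_eq_add_neg i,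
    jetCoeff_of_coupling hF hM hk hh hU i (Or.inl rfl),
    jetCoeff_of_coupling hF hM hk hh hU i (Or.inr rfl), jetCoeff_at_grid hM hk F hh hU i] at h1
  refine le_trans (le_of_eq ?_) h1
  rw [← sub_eq_add_neg]
  congr 1
  split_ifs <;> ring

/-- On constant grid values `jetCoeff F k` vanishes at both ends of the element, so that it is small
if the remainder is. -/
theorem Model.abs_mul_jetCoeff_le (ha : a.natDegree = 1)
    (hF : ContDiff ℝ ∞ F) (hg : ContDiff ℝ ∞ g) (hI : IsOpen I)
    (hM : M.IsSlowManifold a F g I h₀) {k : ℕ} (hk : k ∈ Finset.Ico 1 p) {h : ℝ}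
    (hh : h ∈ Ioo 0 h₀) {c : ℝ} (hc : c ∈ I) {ε : ℝ}
    (hε : ∀ ξ ∈ Icc (-1 : ℝ) 1, |M.remainder a F g k h (fun _ => c) 0 ξ| ≤ ε)
    {ξ : ℝ} (hξ : ξ ∈ Icc (-1 : ℝ) 1) :
    |a.coeff 1 * M.jetCoeff F k (ξ, fun _ => c, h)| ≤ h ^ 2 * ε := by
  have hU : ∀ j : ℤ, (fun _ => c : ℤ → ℝ) j ∈ I := fun _ => hc
  have hφ := (contDiffOn_comp_localPoint (contDiffOn_jetCoeff hM hF k) hh hU 0).const_smul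
    (a.coeff 1)
  simp only [smul_eq_mul] at hφ
  have hΓ : |M.rateCoeff k (stencil r (fun _ => c) 0) h| ≤ ε := by
    have := abs_sub_rateCoeff_le ha hF hg hI hM hk hh hU 0 hε
    rw [show F c + F c - 2 * F c = 0 by ring, ite_self, mul_zero, zero_sub, abs_neg, abs_mul,
      abs_of_pos (pow_pos hh.1 2)] at this
    exact le_of_mul_le_mul_left this (pow_pos hh.1 2)
  have hb : ∀ s : ℤ, s = 1 ∨ s = -1 →
      M.jetCoeff F k (localPoint r h (fun _ => c) 0 (gridPoint h (0 + s))) = 0 := by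
    intro s hs
    rw [jetCoeff_of_coupling hF hM hk hh hU 0 hs, sub_self, ite_self]
  have h1 := abs_le_of_abs_iteratedDeriv_two_le (ε := 2 * ε)
    hh.1 hφ.continuousOn (fun y hy => hφ.contDiffAt (Icc_mem_nhds hy.1 hy.2)) (fun y hy => by
      rw [iteratedDeriv_const_mul_field,
        coeff_one_mul_iteratedDeriv_jetCoeff ha hF hg hI hM (Finset.mem_Ico.1 hk).2 hh hU 0 hy]
      refine (abs_add_le _ _).trans ?_
      linarith [hε _ (div_mem_Icc hh.1 (Ioo_subset_Icc_self hy))])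
    (by rw [← gridPoint_succ, hb 1 (Or.inl rfl), mul_zero])
    (by rw [← gridPoint_pred, sub_eq_add_neg, hb (-1) (Or.inr rfl), mul_zero])
    (y := gridPoint h 0 + ξ * h) (by constructor <;> nlinarith [hξ.1, hξ.2, hh.1])
  rw [localPoint_add h hh.1] at h1
  refine h1.trans (le_of_eq ?_)
  ring

end Equations

section Limits

variable {M : Model p r} {a : ℝ[X]} {F g : ℝ → ℝ} {I : Set ℝ} {h₀ : ℝ}

/-! ### Limits on nearly constant grid values -/

theorem uniqueDiffOn_domain (hI : IsOpen I) : UniqueDiffOn ℝ (domain r I h₀) :=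
  (uniqueDiffOn_Icc (by norm_num)).prod
    ((isOpen_set_pi finite_univ fun _ _ => hI).uniqueDiffOn.prod (uniqueDiffOn_Ico 0 h₀))

theorem Model.hasFDerivAt_fieldCoeff (hI : IsOpen I) (hM : M.IsSlowManifold a F g I h₀) (k : ℕ)
    {z : ℝ × (Fin (2 * r + 1) → ℝ) × ℝ} (hz : z ∈ domain r I h₀) :
    HasFDerivAt (fun w => M.fieldCoeff k (z.1, w, z.2.2))
      ((fderivWithin ℝ (M.fieldCoeff k) (domain r I h₀) z).comp
        ((ContinuousLinearMap.inr ℝ ℝ ((Fin (2 * r + 1) → ℝ) × ℝ)).comp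
          (ContinuousLinearMap.inl ℝ (Fin (2 * r + 1) → ℝ) ℝ))) z.2.1 := by
  have h1 := ((contDiffOn_fieldCoeff hM k).differentiableOn (by norm_num) z hz).hasFDerivWithinAt
  have h2 : HasFDerivAt (fun w : Fin (2 * r + 1) → ℝ => (z.1, w, z.2.2))
      ((ContinuousLinearMap.inr ℝ ℝ ((Fin (2 * r + 1) → ℝ) × ℝ)).comp
          (ContinuousLinearMap.inl ℝ (Fin (2 * r + 1) → ℝ) ℝ)) z.2.1 :=
    (hasFDerivAt_prodMk_right z.1 (z.2.1, z.2.2)).comp z.2.1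
      (hasFDerivAt_prodMk_left z.2.1 z.2.2)
  have h3 : MapsTo (fun w : Fin (2 * r + 1) → ℝ => (z.1, w, z.2.2)) (univ.pi fun _ => I)
      (domain r I h₀) := fun w hw => ⟨hz.1, hw, hz.2.2⟩
  have h4 := HasFDerivWithinAt.comp z.2.1 (g := M.fieldCoeff k) h1
    (h2.hasFDerivWithinAt (s := univ.pi fun _ => I)) h3
  exact h4.hasFDerivAt ((isOpen_set_pi finite_univ fun _ _ => hI).mem_nhds hz.2.1)

theorem Model.continuousOn_fieldDeriv (hI : IsOpen I)
    (hM : M.IsSlowManifold a F g I h₀) (k : ℕ) :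
    ContinuousOn (M.fieldDeriv k) (domain r I h₀) := by
  have h1 := ((contDiffOn_fieldCoeff hM k).continuousOn_fderivWithin
    (uniqueDiffOn_domain hI) (by norm_num)).clm_comp (continuousOn_const
      (c := (ContinuousLinearMap.inr ℝ ℝ ((Fin (2 * r + 1) → ℝ) × ℝ)).comp
          (ContinuousLinearMap.inl ℝ (Fin (2 * r + 1) → ℝ) ℝ)))
  exact h1.congr fun z hz => (hasFDerivAt_fieldCoeff hI hM k hz).fderiv

theorem const_mem_domain (hh₀ : 0 < h₀) {c ξ : ℝ} (hc : c ∈ I) (hξ : ξ ∈ Icc (-1 : ℝ) 1) :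
    ((ξ, fun _ => c, 0) : ℝ × (Fin (2 * r + 1) → ℝ) × ℝ) ∈ domain r I h₀ :=
  ⟨hξ, fun _ _ => hc, le_rfl, hh₀⟩

/-- If the remainder, scaled by `s`, tends to zero at each position of the element as the stencil
values become constant and the spacing tends to zero, it does so uniformly in the element. -/
theorem Model.eventually_abs_mul_remainder_lt (hF : ContDiff ℝ ∞ F) (hg : ContDiff ℝ ∞ g)
    (hI : IsOpen I) (hh₀ : 0 < h₀) (hM : M.IsSlowManifold a F g I h₀) {ι : Type*} {l : Filter ι}
    {h s : ι → ℝ} {U : ι → ℤ → ℝ} {i : ι → ℤ} {c σ : ℝ} {G : ℕ → ℝ} {k : ℕ} (hc : c ∈ I)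
    (hU : ∀ᶠ b in l, ∀ j, U b j ∈ I)
    (hst : Tendsto (fun b => stencil r (U b) (i b)) l (𝓝 fun _ => c))
    (hh : Tendsto h l (𝓝[>] 0)) (hs : Tendsto s l (𝓝 σ))
    (hG : ∀ m < k, Tendsto (fun b => s b • M.rateStencil m (h b) (U b) (i b)) l (𝓝 fun _ => G m))
    (h0 : ∀ ξ ∈ Icc (-1 : ℝ) 1,
      ∑ m ∈ Finset.range k,
          M.fieldDeriv (m + 1) (ξ, fun _ => c, 0) (fun _ => G (k - (m + 1))) -
        σ * (a.coeff 0 * M.jetCoeff F k (ξ, fun _ => c, 0) +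
          M.jetCoeff g k (ξ, fun _ => c, 0)) = 0)
    {ε : ℝ} (hε : 0 < ε) :
    ∀ᶠ b in l, ∀ ξ ∈ Icc (-1 : ℝ) 1, |s b * M.remainder a F g k (h b) (U b) (i b) ξ| < ε := by
  refine isCompact_Icc.eventually_forall_of_eventually_prod fun ξ hξ => ?_
  have hz : Tendsto (fun q : ι × ℝ => (q.2, stencil r (U q.1) (i q.1), h q.1))
      (l ×ˢ 𝓝[Icc (-1) 1] ξ) (𝓝[domain r I h₀] (ξ, fun _ => c, 0)) := by
    refine tendsto_nhdsWithin_iff.2 ⟨?_, ?_⟩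
    · exact (tendsto_snd.mono_right nhdsWithin_le_nhds).prodMk_nhds
        ((hst.comp tendsto_fst).prodMk_nhds
          ((hh.mono_right nhdsWithin_le_nhds).comp tendsto_fst))
    · have e₁ : ∀ᶠ b in l, h b ∈ Ioo 0 h₀ := hh.eventually (Ioo_mem_nhdsGT hh₀)
      filter_upwards [(hU.and e₁).prod_mk (self_mem_nhdsWithin (a := ξ) (s := Icc (-1) 1))]
        with q hq
      exact ⟨hq.2, stencil_mem_pi hq.1.1 _, hq.1.2.1.le, hq.1.2.2⟩
  have hmem := const_mem_domain (r := r) hh₀ hc hξ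
  have hfst : Tendsto Prod.fst (l ×ˢ 𝓝[Icc (-1) 1] ξ) l := tendsto_fst
  have hlim : Tendsto (fun q : ι × ℝ => s q.1 * M.remainder a F g k (h q.1) (U q.1) (i q.1) q.2)
      (l ×ˢ 𝓝[Icc (-1) 1] ξ) (𝓝 0) := by
    rw [← h0 ξ hξ]
    have e : ∀ q : ι × ℝ, s q.1 * M.remainder a F g k (h q.1) (U q.1) (i q.1) q.2 =
        ∑ m ∈ Finset.range k, M.fieldDeriv (m + 1) (q.2, stencil r (U q.1) (i q.1), h q.1)
            (s q.1 • M.rateStencil (k - (m + 1)) (h q.1) (U q.1) (i q.1)) -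
          s q.1 * (a.coeff 0 * M.jetCoeff F k (q.2, stencil r (U q.1) (i q.1), h q.1) +
            M.jetCoeff g k (q.2, stencil r (U q.1) (i q.1), h q.1)) := by
      intro q
      rw [remainder, mul_sub, Finset.mul_sum]
      simp only [map_smul, smul_eq_mul]
    simp only [e]
    refine Tendsto.sub (tendsto_finsetSum _ fun m hm => ?_) ?_
    · have hm' := Finset.mem_range.1 hm
      exact tendsto_clm_apply
        ((continuousOn_fieldDeriv hI hM (m + 1) _ hmem).tendsto.comp hz)
        ((hG (k - (m + 1)) (by omega)).comp hfst)
    · have hj : ∀ {H : ℝ → ℝ}, ContDiff ℝ ∞ H →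
          Tendsto (fun q : ι × ℝ => M.jetCoeff H k (q.2, stencil r (U q.1) (i q.1), h q.1))
            (l ×ˢ 𝓝[Icc (-1) 1] ξ) (𝓝 (M.jetCoeff H k (ξ, fun _ => c, 0))) := fun hH =>
        ((contDiffOn_jetCoeff hM hH k).continuousOn _ hmem).tendsto.comp hz
      exact (hs.comp hfst).mul (((hj hF).const_mul _).add (hj hg))
  have := hlim.eventually (Metric.ball_mem_nhds 0 hε)
  simpa [Metric.mem_ball, Real.dist_eq] using this

theorem Model.jetCoeff_eq_zero_of_fieldCoeff (M : Model p r) (H : ℝ → ℝ) {k : ℕ}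
    (hk : k ∈ Finset.Ico 1 p) {z : ℝ × (Fin (2 * r + 1) → ℝ) × ℝ}
    (hz : ∀ m ∈ Finset.Ico 1 p, M.fieldCoeff m z = 0) : M.jetCoeff H k z = 0 := by
  have hk' := Finset.mem_Ico.1 hk
  rw [jetCoeff, coeff_jet_of_eq_zero _ _ hk'.1 hk'.2, hz k hk, mul_zero]
  exact fun m hm => hz m (Finset.Ico_subset_Ico_right hk'.2.le hm)

/-- On constant grid values where `F` is not critical, the subgrid fields are constant in the
limit `h → 0`. By induction on the order: the rates of lower order are `o(h⁻²)`, so that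
`jetCoeff F k` tends to a function with constant second derivative that vanishes at `-1`, `0`
and `1`. -/
theorem Model.fieldCoeff_const_eq_zero (ha : a.natDegree = 1)
    (hF : ContDiff ℝ ∞ F) (hg : ContDiff ℝ ∞ g) (hI : IsOpen I) (hh₀ : 0 < h₀)
    (hM : M.IsSlowManifold a F g I h₀) {c : ℝ} (hc : c ∈ I) (hFc : deriv F c ≠ 0) {k : ℕ}
    (hk : k ∈ Finset.Ico 1 p) :
    (∀ ξ ∈ Icc (-1 : ℝ) 1, M.fieldCoeff k (ξ, fun _ => c, 0) = 0) ∧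
      Tendsto (fun h : ℝ => h ^ 2 * M.rateCoeff k (fun _ => c) h) (𝓝[>] 0) (𝓝 0) := by
  induction k using Nat.strong_induction_on with
  | _ k ih =>
    have hk' := Finset.mem_Ico.1 hk
    have ha1 : a.coeff 1 ≠ 0 := by
      have : a.leadingCoeff ≠ 0 := leadingCoeff_ne_zero.2 (by rintro rfl; simp at ha)
      rwa [leadingCoeff, ha] at this
    have hU : ∀ j : ℤ, (fun _ => c : ℤ → ℝ) j ∈ I := fun _ => hc
    have hIoo : ∀ᶠ h : ℝ in 𝓝[>] 0, h ∈ Ioo 0 h₀ := Ioo_mem_nhdsGT hh₀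
    have hsq : Tendsto (fun h : ℝ => h ^ 2) (𝓝[>] 0) (𝓝 0) := by
      have : Tendsto (fun h : ℝ => h ^ 2) (𝓝 0) (𝓝 (0 ^ 2)) := (continuous_pow 2).tendsto 0
      rw [zero_pow two_ne_zero] at this
      exact this.mono_left nhdsWithin_le_nhds
    have hrate : ∀ m < k, Tendsto (fun h : ℝ => h ^ 2 * M.rateCoeff m (fun _ => c) h)
        (𝓝[>] 0) (𝓝 0) := by
      intro m hm
      rcases Nat.eq_zero_or_pos m with rfl | hm0
      · have : Tendsto (fun h : ℝ => h ^ 2 * (a.coeff 0 * F c + g c)) (𝓝[>] 0) (𝓝 0) := by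
          simpa using hsq.mul_const (a.coeff 0 * F c + g c)
        refine this.congr' ?_
        filter_upwards [hIoo] with h hh
        have := rateCoeff_zero ha hF hg hI hM (by omega) hh hU 0
        exact congrArg _ this.symm
      · exact (ih m hm (Finset.mem_Ico.2 ⟨hm0, by omega⟩)).2
    have hR : ∀ ε > 0, ∀ᶠ h : ℝ in 𝓝[>] 0, ∀ ξ ∈ Icc (-1 : ℝ) 1,
        |h ^ 2 * M.remainder a F g k h (fun _ => c) 0 ξ| < ε := by
      intro ε hε
      refine eventually_abs_mul_remainder_lt hF hg hI hh₀ hM (l := 𝓝[>] 0) (h := fun h => h)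
        (s := fun h => h ^ 2) (U := fun _ _ => c) (i := fun _ => 0) (G := fun _ => 0) hc
        (Eventually.of_forall fun _ => hU) tendsto_const_nhds tendsto_id hsq ?_ ?_ hε
      · intro m hm
        refine tendsto_pi_nhds.2 fun j => ?_
        exact hrate m hm
      · intro ξ _
        rw [zero_mul, sub_zero]
        exact Finset.sum_eq_zero fun m _ => map_zero _
    have hbound : ∀ ε > 0, ∀ᶠ h : ℝ in 𝓝[>] 0, h ∈ Ioo 0 h₀ ∧ ∀ ξ ∈ Icc (-1 : ℝ) 1,
        |M.remainder a F g k h (fun _ => c) 0 ξ| ≤ ε / h ^ 2 := by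
      intro ε hε
      filter_upwards [hR ε hε, hIoo] with h h1 hh
      refine ⟨hh, fun ξ hξ => ?_⟩
      have := (h1 ξ hξ).le
      rw [abs_mul, abs_of_pos (pow_pos hh.1 2)] at this
      rwa [le_div_iff₀ (pow_pos hh.1 2), mul_comm]
    refine ⟨fun ξ hξ => ?_, ?_⟩
    -- Once the lower coefficients vanish, `jetCoeff F k` is `F' c` times the coefficient `k`.
    · have hjet : M.jetCoeff F k (ξ, fun _ => c, 0) = 0 := by
        have hz : Tendsto (fun h : ℝ => ((ξ, fun _ => c, h) : ℝ × (Fin (2 * r + 1) → ℝ) × ℝ))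
            (𝓝[>] 0) (𝓝[domain r I h₀] (ξ, fun _ => c, 0)) := by
          refine tendsto_nhdsWithin_iff.2 ⟨?_, ?_⟩
          · exact tendsto_const_nhds.prodMk_nhds (tendsto_const_nhds.prodMk_nhds
              (tendsto_id.mono_left nhdsWithin_le_nhds))
          · filter_upwards [hIoo] with h hh
            exact ⟨hξ, fun _ _ => hc, hh.1.le, hh.2⟩
        have hlim := ((contDiffOn_jetCoeff hM hF k).continuousOn _
          (const_mem_domain hh₀ hc hξ)).tendsto.comp hz
        have hlim0 : Tendsto (fun h : ℝ => a.coeff 1 * M.jetCoeff F k (ξ, fun _ => c, h))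
            (𝓝[>] 0) (𝓝 0) := by
          refine Metric.tendsto_nhds.2 fun ε hε => ?_
          filter_upwards [hbound (ε / 2) (by positivity)] with h hh
          have := abs_mul_jetCoeff_le ha hF hg hI hM hk hh.1 hc hh.2 hξ
          rw [mul_div_cancel₀ _ (pow_pos hh.1.1 2).ne'] at this
          rw [Real.dist_eq, sub_zero]
          linarith
        have := tendsto_nhds_unique (hlim.const_mul (a.coeff 1)) hlim0
        exact (mul_eq_zero.1 this).resolve_left ha1
      rw [jetCoeff, coeff_jet_of_eq_zero _ _ hk'.1 hk'.2 fun m hm => by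
        have := Finset.mem_Ico.1 hm
        exact (ih m this.2 (Finset.mem_Ico.2 ⟨this.1, by omega⟩)).1 ξ hξ] at hjet
      exact (mul_eq_zero.1 hjet).resolve_left hFc
    · refine Metric.tendsto_nhds.2 fun ε hε => ?_
      filter_upwards [hbound (ε / 2) (by positivity)] with h hh
      have := abs_sub_rateCoeff_le ha hF hg hI hM hk hh.1 hU 0 hh.2
      rw [show F c + F c - 2 * F c = 0 by ring, ite_self, mul_zero, zero_sub, abs_neg,
        mul_div_cancel₀ _ (pow_pos hh.1.1 2).ne'] at this
      rw [Real.dist_eq, sub_zero]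
      exact this.trans_lt (by linarith)

/-- Since the subgrid fields of `Model.fieldCoeff_const_eq_zero` vanish for all constants near `c`,
so does their derivative in the direction of the constants. -/
theorem Model.fieldDeriv_const_eq_zero (ha : a.natDegree = 1)
    (hF : ContDiff ℝ ∞ F) (hg : ContDiff ℝ ∞ g) (hI : IsOpen I) (hh₀ : 0 < h₀)
    (hM : M.IsSlowManifold a F g I h₀) {c : ℝ} (hc : c ∈ I) (hFc : deriv F c ≠ 0) {k : ℕ}
    (hk : k ∈ Finset.Ico 1 p) {ξ : ℝ} (hξ : ξ ∈ Icc (-1 : ℝ) 1) :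
    M.fieldDeriv k (ξ, fun _ => c, 0) (fun _ => 1) = 0 := by
  have hdiff := hasFDerivAt_fieldCoeff hI hM k (const_mem_domain (r := r) hh₀ hc hξ)
  have h1 : HasDerivAt (fun t : ℝ => fun _ : Fin (2 * r + 1) => t) (fun _ => 1) c :=
    hasDerivAt_pi.2 fun _ => hasDerivAt_id c
  have h2 := hdiff.differentiableAt.hasFDerivAt.comp_hasDerivAt c h1
  have h3 : (fun t : ℝ => M.fieldCoeff k (ξ, fun _ => t, 0)) =ᶠ[𝓝 c] fun _ => 0 := by
    have hcont : Continuous (deriv F) := (contDiff_infty_iff_deriv.1 hF).2.continuous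
    filter_upwards [hI.mem_nhds hc, hcont.continuousAt.eventually_ne hFc] with t ht hFt
    exact (fieldCoeff_const_eq_zero ha hF hg hI hh₀ hM ht hFt hk).1 ξ hξ
  exact h2.unique ((hasDerivAt_const c (0 : ℝ)).congr_of_eventuallyEq h3)

/-- By continuity, `Model.fieldCoeff_const_eq_zero` and `Model.fieldDeriv_const_eq_zero` extend to
the limits of noncritical values of `F`. -/
theorem Model.const_eq_zero_of_mem_closure (ha : a.natDegree = 1)
    (hF : ContDiff ℝ ∞ F) (hg : ContDiff ℝ ∞ g) (hI : IsOpen I) (hh₀ : 0 < h₀)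
    (hM : M.IsSlowManifold a F g I h₀) {c : ℝ} (hc : c ∈ I)
    (hFc : c ∈ closure {x | deriv F x ≠ 0}) {k : ℕ}
    (hk : k ∈ Finset.Ico 1 p) {ξ : ℝ} (hξ : ξ ∈ Icc (-1 : ℝ) 1) :
    M.fieldCoeff k (ξ, fun _ => c, 0) = 0 ∧
      M.fieldDeriv k (ξ, fun _ => c, 0) (fun _ => 1) = 0 := by
  have := mem_closure_iff_nhdsWithin_neBot.1 hFc
  have hIc : ∀ᶠ t in 𝓝[{x | deriv F x ≠ 0}] c, t ∈ I :=
    nhdsWithin_le_nhds (hI.mem_nhds hc)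
  have hz : Tendsto (fun t : ℝ => ((ξ, fun _ => t, 0) : ℝ × (Fin (2 * r + 1) → ℝ) × ℝ))
      (𝓝[{x | deriv F x ≠ 0}] c) (𝓝[domain r I h₀] (ξ, fun _ => c, 0)) := by
    refine tendsto_nhdsWithin_iff.2 ⟨?_, hIc.mono fun t ht => const_mem_domain hh₀ ht hξ⟩
    exact tendsto_const_nhds.prodMk_nhds ((tendsto_pi_nhds.2 fun _ =>
      tendsto_id.mono_left nhdsWithin_le_nhds).prodMk_nhds tendsto_const_nhds)
  have hmem := const_mem_domain (r := r) hh₀ hc hξ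
  constructor
  · refine tendsto_nhds_unique
      (((contDiffOn_fieldCoeff hM k).continuousOn _ hmem).tendsto.comp hz) ?_
    refine tendsto_const_nhds.congr' ?_
    filter_upwards [hIc, self_mem_nhdsWithin] with t ht hFt
    exact ((fieldCoeff_const_eq_zero ha hF hg hI hh₀ hM ht hFt hk).1 ξ hξ).symm
  · refine tendsto_nhds_unique (tendsto_clm_apply
      ((continuousOn_fieldDeriv hI hM k _ hmem).tendsto.comp hz) tendsto_const_nhds) ?_
    refine tendsto_const_nhds.congr' ?_
    filter_upwards [hIc, self_mem_nhdsWithin] with t ht hFt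
    exact (fieldDeriv_const_eq_zero ha hF hg hI hh₀ hM ht hFt hk hξ).symm

end Limits

end Holistic

/-! ### Consistency along smooth fields -/

theorem contDiffOn_deriv_fst {φ : ℝ → ℝ → ℝ} {T : Set ℝ} (hT : IsOpen T)
    (hφ : ContDiffOn ℝ ∞ (fun z : ℝ × ℝ => φ z.1 z.2) (univ ×ˢ T)) :
    ContDiffOn ℝ ∞ (fun z : ℝ × ℝ => deriv (fun y => φ y z.2) z.1) (univ ×ˢ T) := by
  have hopen : IsOpen (univ ×ˢ T : Set (ℝ × ℝ)) := isOpen_univ.prod hT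
  have h1 := (hφ.fderiv_of_isOpen hopen (m := ∞) (by simp)).clm_apply
    (contDiffOn_const (c := ((1, 0) : ℝ × ℝ)))
  refine h1.congr fun z hz => ?_
  have h2 := ((hφ.contDiffAt (hopen.mem_nhds hz)).differentiableAt (by simp)).hasFDerivAt
  have h3 : HasDerivAt (fun y : ℝ => (y, z.2)) (1, 0) z.1 :=
    (hasDerivAt_id z.1).prodMk (hasDerivAt_const z.1 z.2)
  exact (h2.comp_hasDerivAt z.1 h3).deriv

theorem continuousOn_iteratedDeriv_two_fst {φ : ℝ → ℝ → ℝ} {T : Set ℝ} (hT : IsOpen T)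
    (hφ : ContDiffOn ℝ ∞ (fun z : ℝ × ℝ => φ z.1 z.2) (univ ×ˢ T)) :
    ContinuousOn (fun z : ℝ × ℝ => iteratedDeriv 2 (fun y => φ y z.2) z.1) (univ ×ˢ T) := by
  have h1 := contDiffOn_deriv_fst hT hφ
  have h2 := contDiffOn_deriv_fst (φ := fun x t => deriv (fun y => φ y t) x) hT h1
  refine h2.continuousOn.congr fun z _ => ?_
  simp only
  rw [iteratedDeriv_succ, iteratedDeriv_one]

namespace Holistic

variable {p r : ℕ}

open Polynomial

section Approach

variable {ι : Type*} {l : Filter ι} {h t : ι → ℝ} {i : ι → ℤ} {x₀ t₀ : ℝ}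

theorem tendsto_gridPoint_add (hh : Tendsto h l (𝓝[>] 0))
    (hi : Tendsto (fun b => gridPoint (h b) (i b)) l (𝓝 x₀)) (j : ℤ) :
    Tendsto (fun b => gridPoint (h b) (i b + j)) l (𝓝 x₀) := by
  simp only [gridPoint_add]
  simpa using hi.add ((hh.mono_right nhdsWithin_le_nhds).const_mul (j : ℝ))

theorem apply_const_eq_zero {n : ℕ} {L : (Fin n → ℝ) →L[ℝ] ℝ} (hL : L (fun _ => 1) = 0) (y : ℝ) :
    L (fun _ => y) = 0 := by
  have : (fun _ : Fin n => y) = y • fun _ => (1 : ℝ) := by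
    ext
    simp
  rw [this, map_smul, hL, smul_zero]

/-- If a family of grid functions tends to `c` along all grid points that tend to `x₀`, its
stencils do as well. -/
theorem tendsto_stencil {Φ : ι → ℤ → ℝ} {c : ℝ} (hh : Tendsto h l (𝓝[>] 0))
    (hΦ : ∀ i : ι → ℤ, Tendsto (fun b => gridPoint (h b) (i b)) l (𝓝 x₀) →
      Tendsto (fun b => Φ b (i b)) l (𝓝 c))
    (hi : Tendsto (fun b => gridPoint (h b) (i b)) l (𝓝 x₀)) :
    Tendsto (fun b => stencil r (Φ b) (i b)) l (𝓝 fun _ => c) := by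
  refine tendsto_pi_nhds.2 fun j => ?_
  simp only [stencil, add_sub_assoc]
  exact hΦ (fun b => i b + (((j : ℕ) : ℤ) - (r : ℤ))) (tendsto_gridPoint_add hh hi _)

theorem tendsto_second_difference {φ : ℝ → ℝ → ℝ} {T : Set ℝ} (hT : IsOpen T)
    (hφ : ContDiffOn ℝ ∞ (fun z : ℝ × ℝ => φ z.1 z.2) (univ ×ˢ T)) (ht₀ : t₀ ∈ T)
    (hh : Tendsto h l (𝓝[>] 0)) (ht : Tendsto t l (𝓝 t₀))
    (hi : Tendsto (fun b => gridPoint (h b) (i b)) l (𝓝 x₀)) :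
    Tendsto (fun b => (φ (gridPoint (h b) (i b + 1)) (t b) +
        φ (gridPoint (h b) (i b - 1)) (t b) - 2 * φ (gridPoint (h b) (i b)) (t b)) / h b ^ 2) l
      (𝓝 (iteratedDeriv 2 (fun y => φ y t₀) x₀)) := by
  have hopen : IsOpen (univ ×ˢ T : Set (ℝ × ℝ)) := isOpen_univ.prod hT
  set S := iteratedDeriv 2 (fun y => φ y t₀) x₀
  refine Metric.tendsto_nhds.2 fun ε hε => ?_
  have hS := ((continuousOn_iteratedDeriv_two_fst hT hφ).continuousAt
    (hopen.mem_nhds (⟨mem_univ _, ht₀⟩ : (x₀, t₀) ∈ univ ×ˢ T))).eventually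
    (Metric.ball_mem_nhds S (half_pos hε))
  obtain ⟨δ, hδ, hball⟩ := Metric.eventually_nhds_iff_ball.1 hS
  have e₁ : ∀ᶠ b in l, h b ∈ Ioo 0 (δ / 2) := hh.eventually (Ioo_mem_nhdsGT (half_pos hδ))
  filter_upwards [e₁, hi.eventually (Metric.ball_mem_nhds x₀ (half_pos hδ)),
    ht.eventually (Metric.ball_mem_nhds t₀ hδ), ht.eventually (hT.mem_nhds ht₀)]
    with b hb hxb htb hTb
  have hsec : ContDiff ℝ 2 (fun y => φ y (t b)) := by
    have := (contDiffOn_infty.1 hφ 2).comp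
      ((contDiff_id.prodMk contDiff_const).contDiffOn (s := univ) (f := fun y : ℝ => (y, t b)))
      fun y _ => ⟨mem_univ _, hTb⟩
    exact contDiffOn_univ.1 this
  have key := abs_second_difference_sub_le (φ := fun y => φ y (t b)) (A := S) (ε := ε / 2)
    (x := gridPoint (h b) (i b)) hb.1 hsec.continuous.continuousOn
    (fun y _ => hsec.contDiffAt) fun y hy => by
      refine (hball (y, t b) ?_).le
      rw [Metric.mem_ball, Prod.dist_eq, max_lt_iff]
      refine ⟨?_, htb⟩
      have := abs_lt.1 ((Real.dist_eq _ _).symm.trans_lt hxb)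
      rw [Real.dist_eq]
      rw [abs_lt]
      constructor <;> linarith [hb.2, hy.1, hy.2]
  have hpos : 0 < h b ^ 2 := pow_pos hb.1 2
  rw [gridPoint_succ, gridPoint_pred, Real.dist_eq]
  rw [show ∀ A : ℝ, A / h b ^ 2 - S = (A - h b ^ 2 * S) / h b ^ 2 by
    intro A
    rw [sub_div, mul_div_cancel_left₀ _ hpos.ne'], abs_div, abs_of_pos hpos, div_lt_iff₀ hpos]
  nlinarith

variable {M : Model p r} {a : ℝ[X]} {F g : ℝ → ℝ} {I : Set ℝ} {h₀ : ℝ}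

/-- The limit of each coefficient of the evolution law, on the grid values of a smooth field near
a point of space and time: order `0` contributes the reaction terms, order `1` the diffusion, and
the higher orders nothing.

If `F'` vanishes near the limiting value `c`, there is neither coupling nor diffusion. Otherwise
`c` is a limit of noncritical values of `F`, and the remainder vanishes in the limit because the
subgrid fields are constant on constant grid values. Induction on the order covers all grid points
that tend to the given point, hence all points of the stencil. -/
theorem Model.tendsto_rateCoeff (ha : a.natDegree = 1)
    (hF : ContDiff ℝ ∞ F) (hg : ContDiff ℝ ∞ g) (hI : IsOpen I) (hh₀ : 0 < h₀)
    (hM : M.IsSlowManifold a F g I h₀) {T : Set ℝ} {u : ℝ → ℝ → ℝ} (hT : IsOpen T)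
    (hu : ContDiffOn ℝ ∞ (fun z : ℝ × ℝ => u z.1 z.2) (univ ×ˢ T))
    (huI : ∀ x, ∀ t ∈ T, u x t ∈ I) (ht₀ : t₀ ∈ T)
    (hh : Tendsto h l (𝓝[>] 0)) (ht : Tendsto t l (𝓝 t₀))
    (hi : Tendsto (fun b => gridPoint (h b) (i b)) l (𝓝 x₀)) {k : ℕ} (hk : k < p) :
    Tendsto (fun b => M.rateCoeff k
        (stencil r (fun j => u (gridPoint (h b) j) (t b)) (i b)) (h b)) l
      (𝓝 (if k = 0 then a.coeff 0 * F (u x₀ t₀) + g (u x₀ t₀) else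
        if k = 1 then a.coeff 1 * iteratedDeriv 2 (fun y => F (u y t₀)) x₀ else 0)) := by
  have hopen : IsOpen (univ ×ˢ T : Set (ℝ × ℝ)) := isOpen_univ.prod hT
  have hFu : ContDiffOn ℝ ∞ (fun z : ℝ × ℝ => F (u z.1 z.2)) (univ ×ˢ T) := hF.comp_contDiffOn hu
  have hmem : (x₀, t₀) ∈ (univ ×ˢ T : Set (ℝ × ℝ)) := ⟨mem_univ _, ht₀⟩
  have hcont : ContinuousAt (fun z : ℝ × ℝ => u z.1 z.2) (x₀, t₀) :=
    hu.continuousOn.continuousAt (hopen.mem_nhds hmem)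
  have hlim : ∀ {i : ι → ℤ}, Tendsto (fun b => gridPoint (h b) (i b)) l (𝓝 x₀) →
      Tendsto (fun b => u (gridPoint (h b) (i b)) (t b)) l (𝓝 (u x₀ t₀)) := fun hi =>
    hcont.tendsto.comp (hi.prodMk_nhds ht)
  have hc : u x₀ t₀ ∈ I := huI _ _ ht₀
  have hIoo : ∀ᶠ b in l, h b ∈ Ioo 0 h₀ := hh.eventually (Ioo_mem_nhdsGT hh₀)
  have hU : ∀ᶠ b in l, ∀ j, (fun j => u (gridPoint (h b) j) (t b)) j ∈ I :=
    (ht.eventually (hT.mem_nhds ht₀)).mono fun b hb j => huI _ _ hb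
  induction k using Nat.strong_induction_on generalizing i with
  | _ k ih =>
    rcases Nat.eq_zero_or_pos k with rfl | hk0
    · rw [if_pos rfl]
      have : Tendsto (fun b => a.coeff 0 * F (u (gridPoint (h b) (i b)) (t b)) +
          g (u (gridPoint (h b) (i b)) (t b))) l
          (𝓝 (a.coeff 0 * F (u x₀ t₀) + g (u x₀ t₀))) :=
        (((hF.continuous.tendsto _).comp (hlim hi)).const_mul _).add
          ((hg.continuous.tendsto _).comp (hlim hi))
      refine this.congr' ?_
      filter_upwards [hIoo, hU] with b hb hUb
      exact (rateCoeff_zero ha hF hg hI hM hk hb hUb (i b)).symm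
    rw [if_neg (by omega)]
    have hkIco : k ∈ Finset.Ico 1 p := Finset.mem_Ico.2 ⟨hk0, hk⟩
    by_cases hcl : u x₀ t₀ ∈ closure {x | deriv F x ≠ 0}
    · have hR : ∀ ε > 0, ∀ᶠ b in l, ∀ ξ ∈ Icc (-1 : ℝ) 1,
          |1 * M.remainder a F g k (h b) (fun j => u (gridPoint (h b) j) (t b)) (i b) ξ| < ε := by
        intro ε hε
        refine eventually_abs_mul_remainder_lt hF hg hI hh₀ hM (h := h) (s := fun _ => 1) (σ := 1)
          (U := fun b j => u (gridPoint (h b) j) (t b)) (i := i)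
          (G := fun k => if k = 0 then a.coeff 0 * F (u x₀ t₀) + g (u x₀ t₀) else
            if k = 1 then a.coeff 1 * iteratedDeriv 2 (fun y => F (u y t₀)) x₀ else 0)
          hc hU ?_ hh tendsto_const_nhds ?_ ?_ hε
        · exact tendsto_stencil (Φ := fun b j => u (gridPoint (h b) j) (t b)) hh
            (fun i hi => hlim hi) hi
        · intro m hm
          simp only [one_smul]
          exact tendsto_stencil (Φ := fun b j => M.rateCoeff m
            (stencil r (fun j => u (gridPoint (h b) j) (t b)) j) (h b)) hh
            (fun i hi => ih m hm hi (by omega)) hi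
        · intro ξ hξ
          have hz : ∀ m ∈ Finset.Ico 1 p, M.fieldCoeff m (ξ, fun _ => u x₀ t₀, 0) = 0 :=
            fun m hm => (const_eq_zero_of_mem_closure ha hF hg hI hh₀ hM hc hcl hm hξ).1
          rw [jetCoeff_eq_zero_of_fieldCoeff M F hkIco hz,
            jetCoeff_eq_zero_of_fieldCoeff M g hkIco hz, Finset.sum_eq_zero]
          · simp
          · intro m hm
            have hm' := Finset.mem_range.1 hm
            have hd := (const_eq_zero_of_mem_closure ha hF hg hI hh₀ hM hc hcl
              (k := m + 1) (Finset.mem_Ico.2 ⟨by omega, by omega⟩) hξ).2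
            exact apply_const_eq_zero hd _
      have hdiff : Tendsto (fun b => a.coeff 1 * (if k = 1 then
            (F (u (gridPoint (h b) (i b + 1)) (t b)) + F (u (gridPoint (h b) (i b - 1)) (t b)) -
              2 * F (u (gridPoint (h b) (i b)) (t b))) / h b ^ 2 else 0)) l
          (𝓝 (if k = 1 then a.coeff 1 * iteratedDeriv 2 (fun y => F (u y t₀)) x₀ else 0)) := by
        split_ifs
        · exact (tendsto_second_difference (φ := fun x t => F (u x t)) hT hFu ht₀ hh ht
            hi).const_mul _
        · simpa only [mul_zero] using tendsto_const_nhds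
      have hsub : Tendsto (fun b => a.coeff 1 * (if k = 1 then
            (F (u (gridPoint (h b) (i b + 1)) (t b)) + F (u (gridPoint (h b) (i b - 1)) (t b)) -
              2 * F (u (gridPoint (h b) (i b)) (t b))) / h b ^ 2 else 0) -
          M.rateCoeff k (stencil r (fun j => u (gridPoint (h b) j) (t b)) (i b)) (h b)) l
          (𝓝 0) := by
        refine Metric.tendsto_nhds.2 fun ε hε => ?_
        filter_upwards [hR (ε / 2) (half_pos hε), hIoo, hU] with b hRb hb hUb
        have hpos : 0 < h b ^ 2 := pow_pos hb.1 2
        have hbound := abs_sub_rateCoeff_le ha hF hg hI hM hkIco hb hUb (i b) (ε := ε / 2)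
          fun ξ hξ => by simpa using (hRb ξ hξ).le
        rw [Real.dist_eq, sub_zero]
        refine lt_of_le_of_lt ?_ (half_lt_self hε)
        refine le_of_mul_le_mul_left (le_trans (le_of_eq ?_) hbound) hpos
        rw [← abs_of_pos hpos, ← abs_mul, abs_of_pos hpos]
        congr 1
        split_ifs
        · rw [mul_sub, mul_left_comm, mul_div_cancel₀ _ hpos.ne']
        · ring
      simpa using hdiff.sub hsub
    · have hF0 : ∀ᶠ c in 𝓝 (u x₀ t₀), deriv F c = 0 := by
        filter_upwards [isClosed_closure.isOpen_compl.mem_nhds hcl] with c hcc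
        by_contra hne
        exact hcc (subset_closure hne)
      have hS : iteratedDeriv 2 (fun y => F (u y t₀)) x₀ = 0 := by
        have hux : Continuous fun y : ℝ => (y, t₀) := by fun_prop
        have hev : deriv (fun y => F (u y t₀)) =ᶠ[𝓝 x₀] fun _ => 0 := by
          filter_upwards [(hcont.comp (f := fun y : ℝ => (y, t₀)) hux.continuousAt).eventually hF0]
            with y hy
          have hdu : DifferentiableAt ℝ (fun y => u y t₀) y :=
            ((hu.contDiffAt (hopen.mem_nhds ⟨mem_univ y, ht₀⟩)).differentiableAt (by simp)).comp
              (f := fun y : ℝ => (y, t₀)) y (by fun_prop)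
          have hd := ((hF.differentiable (by simp) (u y t₀)).hasDerivAt.comp y hdu.hasDerivAt).deriv
          refine hd.trans ?_
          simp only [Function.comp] at hy
          rw [hy, zero_mul]
        rw [iteratedDeriv_succ, iteratedDeriv_one, hev.deriv_eq]
        simp
      rw [hS, mul_zero, ite_self]
      refine tendsto_const_nhds.congr' ?_
      filter_upwards [hIoo, hU, (hlim hi).eventually hF0.eventually_nhds] with b hb hUb hFb
      exact (rateCoeff_of_eventually_const ha hF hg hI hM hkIco hb hUb (i b) hFb).symm

theorem Model.tendsto_evolution_sub (ha : a.natDegree = 1)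
    (hF : ContDiff ℝ ∞ F) (hg : ContDiff ℝ ∞ g) (hp : 2 ≤ p) (hI : IsOpen I) (hh₀ : 0 < h₀)
    (hM : M.IsSlowManifold a F g I h₀) {T : Set ℝ} {u : ℝ → ℝ → ℝ} (hT : IsOpen T)
    (hu : ContDiffOn ℝ ∞ (fun z : ℝ × ℝ => u z.1 z.2) (univ ×ˢ T))
    (huI : ∀ x, ∀ t ∈ T, u x t ∈ I) (ht₀ : t₀ ∈ T)
    (hh : Tendsto h l (𝓝[>] 0)) (ht : Tendsto t l (𝓝 t₀))
    (hi : Tendsto (fun b => gridPoint (h b) (i b)) l (𝓝 x₀)) :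
    Tendsto (fun b => M.evolution (h b) 1 (fun j => u (gridPoint (h b) j) (t b)) (i b) -
      (evenOperator a (fun y => F (u y (t b))) (gridPoint (h b) (i b)) +
        g (u (gridPoint (h b) (i b)) (t b)))) l (𝓝 0) := by
  have hopen : IsOpen (univ ×ˢ T : Set (ℝ × ℝ)) := isOpen_univ.prod hT
  have hmem : (x₀, t₀) ∈ (univ ×ˢ T : Set (ℝ × ℝ)) := ⟨mem_univ _, ht₀⟩
  have hFu : ContDiffOn ℝ ∞ (fun z : ℝ × ℝ => F (u z.1 z.2)) (univ ×ˢ T) := hF.comp_contDiffOn hu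
  have hu₀ := (hu.continuousOn.continuousAt (hopen.mem_nhds hmem)).tendsto.comp
    (hi.prodMk_nhds ht)
  have hS₀ := ((continuousOn_iteratedDeriv_two_fst (φ := fun x t => F (u x t)) hT
    hFu).continuousAt (hopen.mem_nhds hmem)).tendsto.comp (hi.prodMk_nhds ht)
  have h1 := tendsto_finsetSum (Finset.range p) fun k hk =>
    tendsto_rateCoeff ha hF hg hI hh₀ hM hT hu huI ht₀ hh ht hi (Finset.mem_range.1 hk)
  have hsum : ∑ k ∈ Finset.range p,
      (if k = 0 then a.coeff 0 * F (u x₀ t₀) + g (u x₀ t₀) else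
        if k = 1 then a.coeff 1 * iteratedDeriv 2 (fun y => F (u y t₀)) x₀ else 0) =
      a.coeff 0 * F (u x₀ t₀) + a.coeff 1 * iteratedDeriv 2 (fun y => F (u y t₀)) x₀ +
        g (u x₀ t₀) := by
    obtain ⟨q, rfl⟩ : ∃ q, p = q + 2 := ⟨p - 2, by omega⟩
    rw [Finset.sum_range_succ', Finset.sum_range_succ']
    simp
    ring
  rw [hsum] at h1
  have h2 := ((((hF.continuous.tendsto _).comp hu₀).const_mul (a.coeff 0)).add
    (hS₀.const_mul (a.coeff 1))).add ((hg.continuous.tendsto _).comp hu₀)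
  have h3 := h1.sub h2
  rw [sub_self] at h3
  refine h3.congr fun b => ?_
  rw [evolution_eq_sum, evenOperator_of_natDegree_eq_one ha]
  simp

end Approach

end Holistic

theorem mainTheorem4 (a : Polynomial ℝ) (ha : a.natDegree = 1)
    (F g : ℝ → ℝ) (hF : ContDiff ℝ ∞ F) (hg : ContDiff ℝ ∞ g)
    (p r : ℕ) (hp : 2 ≤ p) (I : Set ℝ) (hI : IsOpen I) (h₀ : ℝ) (hh₀ : 0 < h₀)
    (M : Holistic.Model p r) (hM : M.IsSlowManifold a F g I h₀) :
    M.IsConsistent a F g I h₀ := by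
  intro T u hT hu huI K hK hKT ε hε
  have hunif : ∀ᶠ h in 𝓝[>] (0 : ℝ), ∀ z ∈ K, ∀ i : ℤ, Holistic.gridPoint h i = z.1 →
      |M.evolution h 1 (fun j => u (Holistic.gridPoint h j) z.2) i -
        (Holistic.evenOperator a (fun y => F (u y z.2)) (Holistic.gridPoint h i) +
          g (u (Holistic.gridPoint h i) z.2))| < ε := by
    refine hK.eventually_forall_of_eventually_prod fun z hz => ?_
    -- A triple `(h, i, t)` tends to `(0, z)` if `(h, (X_i, t))` does.
    let f : ℝ × ℤ × ℝ → ℝ × ℝ × ℝ := fun b => (b.1, Holistic.gridPoint b.1 b.2.1, b.2.2)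
    have hf : Tendsto f (comap f (𝓝[>] 0 ×ˢ 𝓝[K] z)) (𝓝[>] 0 ×ˢ 𝓝[K] z) := tendsto_comap
    have hz₂ : Tendsto (fun b => (f b).2) (comap f (𝓝[>] 0 ×ˢ 𝓝[K] z)) (𝓝 z) :=
      (tendsto_snd.comp hf).mono_right nhdsWithin_le_nhds
    have hlim := Holistic.Model.tendsto_evolution_sub ha hF hg hp hI hh₀ hM hT hu huI
      (hKT hz).2 (h := fun b => (f b).1) (t := fun b => (f b).2.2)
      (tendsto_fst.comp hf) ((continuous_snd.tendsto z).comp hz₂)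
      (i := fun b => b.2.1) ((continuous_fst.tendsto z).comp hz₂)
    -- Being eventual along the pulled back filter is uniformity over all `i` with the given `X_i`.
    have hev := eventually_comap.1 (hlim.eventually (Metric.ball_mem_nhds 0 hε))
    filter_upwards [hev] with q hq i hi
    have := hq (q.1, i, q.2.2) (by simp [f, hi])
    simpa [Metric.mem_ball, Real.dist_eq, f] using this
  obtain ⟨h₂, hh₂, hsub⟩ := mem_nhdsGT_iff_exists_Ioo_subset.1 hunif
  refine ⟨min h₂ h₀, ⟨lt_min hh₂ hh₀, min_le_right _ _⟩, fun h hh i t hK' => ?_⟩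
  have hb := hsub ⟨hh.1, hh.2.trans_le (min_le_left _ _)⟩ _ hK' i rfl
  refine ⟨hb, fun hsol => ?_⟩
  rw [hsol _ t (hKT hK').2, abs_sub_comm]
  exact hb
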